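/- Let $B_n$ ($n\ge 0$) be the group of signed permutations $\pi$ of $\{\pm1,\ldots,\pm n\}$ (so $\pi_{-i}=-\pi_i$, where $\pi_i=\pi(i)$), with simple reflections $s_0=(1\;{-1})$ and $s_i=(i\;\,i{+}1)({-i}\;\,{-i{-}1})$ for $1\le i<n$, length function $\ell$, and reflections $(a\;{-a})$, and $(a\;b)({-a}\;{-b})$ with $|a|\ne|b|$. The weak order is defined by $u\le w$ if and only if $\operatorname{inv}(u)\subseteq\operatorname{inv}(w)$, where $\operatorname{inv}(w)$ is the set of reflections $t$ with $\ell(tw)<\ell(w)$. An element is join-irreducible if it covers exactly one element. The canonical join representation of $x$ is the antichain $X$ with $x=\bigvee X$ such that, whenever $x=\bigvee X'$, the order ideal generated by $X'$ contains the order ideal generated by $X$. An arc $\alpha$ on the points $-n<\cdots<-1<1<\cdots<n$ of a vertical line (considered up to combinatorial equivalence) is given by its endpoints $p<q$ and a partition of the points strictly between $p$ and $q$ into the set $L(\alpha)$ of points left of $\alpha$ and the set $R(\alpha)$ of points right of $\alpha$. Its image $-\alpha$ under the half turn $x\mapsto-x$ has endpoints $-q<-p$, with $L(-\alpha)=-R(\alpha)$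 and $R(-\alpha)=-L(\alpha)$. Two arcs are compatible if they do not share their upper endpoint, do not share their lower endpoint, and do not cross. A symmetric arc is an arc with $-\alpha=\alpha$; a symmetric pair is a set $\{\alpha,-\alpha\}$ with $-\alpha\neq\alpha$ and $\alpha,-\alpha$ compatible. For $\pi\in B_n$, the diagram $\delta(\pi)$ has one arc for each descent $\pi_i>\pi_{i'}$ at adjacent positions $i<i'$ of the long one-line notation $\pi_{-n}\cdots\pi_{-1}\pi_1\cdots\pi_n$; this arc connects $\pi_i$ to $\pi_{i'}$, and a value strictly between $\pi_{i'}$ and $\pi_i$ is left of it if it occurs before position $i$, and right of it if it occurs after position $i'$. To a symmetric arc or symmetric pair $A$ associate the signed permutation $j_A$ whose one-line notation $\pi_1\cdots\pi_n$ is as follows (sets are written in increasing order; $a\cdots b$ is an increasing run of consecutive integers, possibly empty). If $A=\{\alpha\}$ is a symmetric arc with endpoints $-p<p$: \[(-p)\,R(\alpha)\,(p+1)\cdots n.\] If $A=\{\alpha,-\alpha\}$ is a symmetric pair, name its arcs so that $\alpha$ is the arc connecting positive points if there is one, and so that $\alpha$ is the one to the right of the other if each arc connects a negative point to a positive point, and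 let $p<q$ be the endpoints of $\alpha$. Then $j_A$ is \[1\cdots(p-1)\,L(\alpha)\,q\,p\,R(\alpha)\,(q+1)\cdots n\quad\text{if } 0<p<q,\] \[[(0,-p)\cap L(\alpha)\cap-L(\alpha)]\,[(-p,q)\cap L(\alpha)]\,q\,p\,R(\alpha)\,(q+1)\cdots n\quad\text{if } p<0<-p<q,\] \[[(0,q)\cap L(\alpha)\cap-L(\alpha)]\,q\,p\,R(\alpha)\,[(q,-p)\cap-L(\alpha)]\,(-p+1)\cdots n\quad\text{if } p<0<q<-p.\] \textbf{Theorem.} Let $\pi\in B_n$. For each symmetric arc or symmetric pair $A\subseteq\delta(\pi)$, the signed permutation $j_A$ is well defined, and it is the unique join-irreducible element $j$ of $B_n$ with $\delta(j)=A$. The canonical join representation of $\pi$ in the weak order is the set of all $j_A$, where $A$ runs over the symmetric arcs and symmetric pairs of arcs contained in $\delta(\pi)$. -/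

import Mathlib

noncomputable section

namespace TypeB

/-- The points `-n, …, -1, 1, …, n`, with the order inherited from `ℤ`. -/
abbrev Pt (n : ℕ) : Type := {x : ℤ // x ≠ 0 ∧ |x| ≤ (n : ℤ)}

instance instFinitePt (n : ℕ) : Finite (Pt n) :=
  ((Set.finite_Icc (-(n : ℤ)) (n : ℤ)).subset
    (fun _ hx => abs_le.mp hx.2 : {x : ℤ | x ≠ 0 ∧ |x| ≤ (n : ℤ)} ⊆ _)).to_subtype

instance instNegPt (n : ℕ) : Neg (Pt n) :=
  ⟨fun x => ⟨-x.1, neg_ne_zero.mpr x.2.1, by rw [abs_neg]; exact x.2.2⟩⟩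

theorem neg_lt_neg_pt {n : ℕ} {x y : Pt n} (h : x < y) : -y < -x :=
  neg_lt_neg (show x.1 < y.1 from h)

theorem neg_neg_pt {n : ℕ} (x : Pt n) : - -x = x := Subtype.ext (neg_neg x.1)

/-! ### Signed permutations and the weak order -/

/-- The group of signed permutations, inside all permutations of the points. -/
def signedPermGroup (n : ℕ) : Subgroup (Equiv.Perm (Pt n)) where
  carrier := {π | ∀ x, π (-x) = -π x}
  one_mem' := fun _ => rfl
  mul_mem' := by
    intro a b ha hb x
    rw [Equiv.Perm.mul_apply, Equiv.Perm.mul_apply, hb, ha]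
  inv_mem' := by
    intro a ha x
    rw [Equiv.Perm.inv_eq_iff_eq, ha]; exact congrArg _ (a.apply_symm_apply x).symm

/-- The group `B_n`; the product is composition. -/
abbrev SignedPerm (n : ℕ) : Type := ↥(signedPermGroup n)

/-- The simple reflections `s₀ = (1 -1)` and `s_i = (i i+1)(-i -i-1)`, `1 ≤ i ≤ n - 1`. -/
def IsSimpleReflection {n : ℕ} (s : SignedPerm n) : Prop :=
  (∃ a : Pt n, a.1 = 1 ∧ s.1 = Equiv.swap a (-a)) ∨
  (∃ a b : Pt n, 0 < a.1 ∧ b.1 = a.1 + 1 ∧ s.1 = Equiv.swap a b * Equiv.swap (-a) (-b))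

/-- The reflections `(i -i)`, and `(i j)(-i -j)` for `|i| ≠ |j|`. -/
def IsReflection {n : ℕ} (t : SignedPerm n) : Prop :=
  (∃ a : Pt n, t.1 = Equiv.swap a (-a)) ∨
  (∃ a b : Pt n, |a.1| ≠ |b.1| ∧ t.1 = Equiv.swap a b * Equiv.swap (-a) (-b))

/-- The length of `w` in the alphabet of simple reflections. -/
def coxLength {n : ℕ} (w : SignedPerm n) : ℕ :=
  sInf {k | ∃ l : List (SignedPerm n), l.length = k ∧ (∀ s ∈ l, IsSimpleReflection s) ∧ l.prod = w}

/-- The set of (left) inversions of `w`. -/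
def inversions {n : ℕ} (w : SignedPerm n) : Set (SignedPerm n) :=
  {t | IsReflection t ∧ coxLength (t * w) < coxLength w}

/-- The (right) weak order: `u ≤ w` when every inversion of `u` is an inversion of `w`. -/
instance weakOrder (n : ℕ) : Preorder (SignedPerm n) := Preorder.lift inversions

/-! ### Canonical join representations -/

/-- `j` covers exactly one element. -/
def IsJoinIrreducible {L : Type*} [Preorder L] (j : L) : Prop := ∃! k, k ⋖ j

/-- `X` is the canonical join representation of `x`: an antichain with join `x` such that the
order ideal it generates lies in the one generated by any other set with join `x`. -/
structure IsCanonicalJoinRep {L : Type*} [Preorder L] (x : L) (X : Set L) : Prop where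
  antichain : IsAntichain (· ≤ ·) X
  isLUB : IsLUB X x
  minimal : ∀ X' : Set L, IsLUB X' x → lowerClosure X ≤ lowerClosure X'

/-! ### Arcs and arc diagrams -/

/-- An arc up to combinatorial equivalence: its two endpoints, and the set of those points
strictly between them (in height) that lie to the right of the arc. -/
@[ext] structure Arc (n : ℕ) where
  lower : Pt n
  upper : Pt n
  right : Set (Pt n)
  lower_lt_upper : lower < upper
  right_subset : right ⊆ Set.Ioo lower upper

namespace Arc

variable {n : ℕ}

/-- The points between the endpoints that lie to the left of the arc. -/
def left (α : Arc n) : Set (Pt n) := Set.Ioo α.lower α.upper \ α.right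

/-- The image of an arc under the half turn `x ↦ -x`, which exchanges left and right. -/
instance instNegArc : Neg (Arc n) where
  neg α :=
    { lower := -α.upper
      upper := -α.lower
      right := {x | -x ∈ α.left}
      lower_lt_upper := neg_lt_neg_pt α.lower_lt_upper
      right_subset := by
        intro x hx
        have h := hx.1
        constructor
        · simpa only [neg_neg_pt] using neg_lt_neg_pt h.2
        · simpa only [neg_neg_pt] using neg_lt_neg_pt h.1 }

def IsEndpoint (α : Arc n) (x : Pt n) : Prop := x = α.lower ∨ x = α.upper

/-- At the height of the point `x`, the arc `α` is strictly to the right of the arc `β`: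
`α` ends at `x` or passes right of it, `β` ends at `x` or passes left of it, not both end there. -/
def RightAt (α β : Arc n) (x : Pt n) : Prop :=
  (x ∈ α.left ∨ α.IsEndpoint x) ∧ (x ∈ β.right ∨ β.IsEndpoint x) ∧
    ¬ (α.IsEndpoint x ∧ β.IsEndpoint x)

/-- The arcs have distinct upper endpoints and distinct lower endpoints, and they do not cross:
neither passes from one side of the other to the opposite side. -/
def Compatible (α β : Arc n) : Prop :=
  α.upper ≠ β.upper ∧ α.lower ≠ β.lower ∧ ¬ ((∃ x, α.RightAt β x) ∧ (∃ y, β.RightAt α y))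

/-- For compatible arcs: `α` is to the right of `β`. -/
def RightOf (α β : Arc n) : Prop := ∃ x, α.RightAt β x

end Arc

/-- The arc diagram `δ(π)`: for each descent `π_i > π_{i'}` at adjacent positions `i < i'` of
the long one-line notation, an arc from `π_i` down to `π_{i'}` that has on its right those
intermediate values that occur after position `i'` (and on its left those before `i`). -/
def delta {n : ℕ} (π : SignedPerm n) : Set (Arc n) :=
  {α | ∃ i i' : Pt n, i ⋖ i' ∧ α.upper = π.1 i ∧ α.lower = π.1 i' ∧
    α.right = {x | π.1 i' < x ∧ x < π.1 i ∧ ∃ k, i' < k ∧ π.1 k = x}}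

/-- The set `A` consists of one symmetric arc. -/
def IsSymmetricArc {n : ℕ} (A : Set (Arc n)) : Prop := ∃ α : Arc n, -α = α ∧ A = {α}

/-- The set `A` is a symmetric pair of arcs. -/
def IsSymmetricPair {n : ℕ} (A : Set (Arc n)) : Prop :=
  ∃ α : Arc n, -α ≠ α ∧ α.Compatible (-α) ∧ A = {α, -α}

/-- The symmetric arcs and symmetric pairs of arcs of an arc diagram `D`. -/
def symmetricParts {n : ℕ} (D : Set (Arc n)) : Set (Set (Arc n)) :=
  {A | (IsSymmetricArc A ∨ IsSymmetricPair A) ∧ A ⊆ D}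

/-! ### The join-irreducible element of a symmetric arc or pair -/

/-- The elements of a set of points, in increasing order. -/
def increasing {n : ℕ} (S : Set (Pt n)) : List (Pt n) := S.toFinite.toFinset.sort (· ≤ ·)

/-- The (short) one-line notation `π_1 π_2 ⋯ π_n`. -/
def oneLine {n : ℕ} (π : SignedPerm n) : List (Pt n) :=
  (increasing {i : Pt n | 0 < i.1}).map π.1

/-- The arc `α` of the symmetric arc or pair `{α, -α}` in terms of which the corresponding
join-irreducible element is written: the symmetric arc itself, or the upper arc of a
non-overlapping pair, or the right arc of an overlapping pair. -/
def IsPreferred {n : ℕ} (α : Arc n) : Prop :=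
  -α = α ∨ 0 < α.lower.1 ∨ (-α ≠ α ∧ α.lower.1 < 0 ∧ 0 < α.upper.1 ∧ α.RightOf (-α))

/-- The one-line notation of the join-irreducible element, for a preferred arc `α` with
endpoints `p < q`; the four cases are `p = -q`, `0 < p < q`, `p < 0 < -p < q`
and `p < 0 < q < -p`. -/
def jiWord {n : ℕ} (α : Arc n) : List (Pt n) :=
  let p := α.lower
  let q := α.upper
  let L := α.left
  let R := α.right
  if p = -q then
    [p] ++ increasing R ++ increasing {x | q < x}
  else if 0 < p.1 then
    increasing {x | 0 < x.1 ∧ x < p} ++ increasing L ++ [q, p] ++ increasing R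
      ++ increasing {x | q < x}
  else if -p < q then
    increasing {x | 0 < x.1 ∧ x < -p ∧ x ∈ L ∧ -x ∈ L} ++ increasing {x | -p < x ∧ x < q ∧ x ∈ L}
      ++ [q, p] ++ increasing R ++ increasing {x | q < x}
  else
    increasing {x | 0 < x.1 ∧ x < q ∧ x ∈ L ∧ -x ∈ L} ++ [q, p] ++ increasing R
      ++ increasing {x | q < x ∧ x < -p ∧ -x ∈ L} ++ increasing {x | -p < x}

/-- The signed permutation `j` corresponds to the symmetric arc or pair `A`. -/
def Corresponds {n : ℕ} (j : SignedPerm n) (A : Set (Arc n)) : Prop :=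
  ∃ α ∈ A, IsPreferred α ∧ oneLine j = jiWord α

end TypeB

end

open TypeB

namespace TypeB

variable {n : ℕ}

/-! ### Points, positions and inverted pairs of values -/

/-! The weak order is containment of sets of inverted pairs of values, a pair being inverted when
its larger value comes first. By strong exchange, left multiplication by the reflection that sends
one value of a pair to the other shortens `w` exactly when the pair is inverted
(`coxLength_mul_lt_iff`), whence `weak_le_iff`.

An arc `α` carries the pairs `α.Inverts`. Any `u` that inverts the pairs of all arcs of `π` lies
above `π` (`Inv.of_arcs`), because each inversion of `π` either splits at an intermediate value or
belongs to a single arc. So `delta` is injective, and a `j` with `delta j = {α, -α}` is below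
exactly those elements that invert the pairs of `α`.

Conversely, an element below `π` that inverts merely the endpoints of an arc `α` of `π` inverts all
the pairs of `α` (`Arc.Inverts.inv_of_le`), hence lies above `j`. Undoing the descent of `α` in `π`
gives the largest `u ≤ π` that does not invert these endpoints, and `u < π`. If `X'` has join `π`,
some member of `X'` is not below `u`, so it lies above `j`: this is the minimality of the canonical
representation. The case `π = j` shows that `u` is the greatest element strictly below `j`, so `j`
is join-irreducible.

It remains to realise each symmetric arc or pair. The long notation of `j` has three increasing
runs: a last run that starts at the lower endpoint of `α`, its negative as first run, and the
remaining values in the middle. Compatibility of `α` and `-α`, with `α` the right arc if they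
overlap, makes the runs disjoint (`IsPreferred.admissible`). The positive half of this notation is
`jiWord α`. -/

theorem coe_neg_pt (x : Pt n) : (-x).1 = -x.1 := rfl

theorem lt_iff_coe {x y : Pt n} : x < y ↔ x.1 < y.1 := Iff.rfl

theorem le_iff_coe {x y : Pt n} : x ≤ y ↔ x.1 ≤ y.1 := Iff.rfl

theorem eq_iff_coe {x y : Pt n} : x = y ↔ x.1 = y.1 := Subtype.ext_iff

theorem neg_lt_neg_pt_iff {x y : Pt n} : -x < -y ↔ y < x := by
  rw [lt_iff_coe, lt_iff_coe, coe_neg_pt, coe_neg_pt, neg_lt_neg_iff]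

theorem neg_inj_pt {x y : Pt n} : -x = -y ↔ x = y := by
  rw [eq_iff_coe, eq_iff_coe, coe_neg_pt, coe_neg_pt, neg_inj]

theorem neg_ne_self_pt (x : Pt n) : -x ≠ x := by
  intro h
  rw [eq_iff_coe, coe_neg_pt] at h
  exact x.2.1 (by omega)

/-- The position of the value `x` in the long one-line notation of `π`. -/
def pos (π : SignedPerm n) (x : Pt n) : Pt n := π.1.symm x

@[simp] theorem pos_apply (π : SignedPerm n) (x : Pt n) : pos π (π.1 x) = x :=
  π.1.symm_apply_apply x

@[simp] theorem apply_pos (π : SignedPerm n) (x : Pt n) : π.1 (pos π x) = x :=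
  π.1.apply_symm_apply x

theorem apply_neg (π : SignedPerm n) (x : Pt n) : π.1 (-x) = -π.1 x := π.2 x

theorem pos_neg (π : SignedPerm n) (x : Pt n) : pos π (-x) = -pos π x := by
  apply π.1.injective
  rw [apply_pos, apply_neg, apply_pos]

theorem pos_inj {π : SignedPerm n} {x y : Pt n} : pos π x = pos π y ↔ x = y :=
  π.1.symm.injective.eq_iff

theorem pos_mul (u v : SignedPerm n) (x : Pt n) : pos (u * v) x = pos v (pos u x) := by
  apply (u * v).1.injective
  rw [apply_pos]
  change x = u.1 (v.1 _)
  rw [apply_pos, apply_pos]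

theorem mul_apply_pt (u v : SignedPerm n) (x : Pt n) : (u * v).1 x = u.1 (v.1 x) := rfl

/-- The values `a < b` are inverted in `π`. -/
def Inv (π : SignedPerm n) (a b : Pt n) : Prop := a < b ∧ pos π b < pos π a

theorem Inv.neg {π : SignedPerm n} {a b : Pt n} (h : Inv π a b) : Inv π (-b) (-a) := by
  refine ⟨neg_lt_neg_pt h.1, ?_⟩
  rw [pos_neg, pos_neg]
  exact neg_lt_neg_pt h.2

theorem Inv.trans {π : SignedPerm n} {a b c : Pt n} (h : Inv π a b) (h' : Inv π b c) :
    Inv π a c := ⟨h.1.trans h'.1, h'.2.trans h.2⟩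

theorem pos_lt_of_not_inv {π : SignedPerm n} {a b : Pt n} (hab : a < b) (h : ¬ Inv π a b) :
    pos π a < pos π b := by
  rcases lt_trichotomy (pos π a) (pos π b) with h1 | h1 | h1
  · exact h1
  · exact absurd (pos_inj.mp h1) hab.ne
  · exact absurd ⟨hab, h1⟩ h

/-- Inverted pairs determine the relative order of all positions, so `pos w ∘ u` is an increasing
permutation of a finite chain, that is, the identity. -/
theorem eq_of_inv_iff {u w : SignedPerm n} (h : ∀ a b, Inv u a b ↔ Inv w a b) : u = w := by
  have key : ∀ a b, pos u a < pos u b → pos w a < pos w b := by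
    intro a b hab
    rcases lt_trichotomy a b with h1 | h1 | h1
    · refine pos_lt_of_not_inv h1 fun h2 => ?_
      exact lt_asymm hab ((h a b).mpr h2).2
    · exact absurd hab (by rw [h1]; exact lt_irrefl _)
    · exact ((h b a).mp ⟨h1, hab⟩).2
  have hm : StrictMono fun x => pos w (u.1 x) := by
    intro x y hxy
    exact key _ _ (by simpa using hxy)
  have hr : Set.range (fun x => pos w (u.1 x)) = Set.range (id : Pt n → Pt n) := by
    rw [Set.range_id, Set.range_eq_univ]
    intro x
    exact ⟨pos u (w.1 x), by simp⟩
  have he := (StrictMono.range_inj hm strictMono_id).mp hr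
  apply Subtype.ext
  apply Equiv.ext
  intro x
  have := congrFun he x
  simp only [id] at this
  rw [← apply_pos w (u.1 x), this]

/-! ### Reflections -/

theorem swap_mul_swap_apply {a b : Pt n} (hab : |a.1| ≠ |b.1|) (x : Pt n) :
    (Equiv.swap a b * Equiv.swap (-a) (-b)) x =
      if x = a then b else if x = b then a else if x = -a then -b else if x = -b then -a else x := by
  have h1 : a ≠ b := fun h => hab (by rw [h])
  have h2 : a ≠ -b := fun h => hab (by rw [h, coe_neg_pt, abs_neg])
  have h3 : b ≠ -a := fun h => hab (by rw [h, coe_neg_pt, abs_neg])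
  have h4 : -a ≠ -b := fun h => h1 (neg_inj_pt.mp h)
  have h5 := neg_ne_self_pt a
  have h6 := neg_ne_self_pt b
  rw [Equiv.Perm.mul_apply]
  simp only [Equiv.swap_apply_def]
  split_ifs <;> simp only [ne_eq, eq_iff_coe, coe_neg_pt] at * <;> omega

theorem IsSimpleReflection.isReflection {s : SignedPerm n} (h : IsSimpleReflection s) :
    IsReflection s := by
  rcases h with ⟨a, -, h⟩ | ⟨a, b, ha, hb, h⟩
  · exact Or.inl ⟨a, h⟩
  · refine Or.inr ⟨a, b, ?_, h⟩
    rw [abs_of_pos ha, abs_of_pos (by omega)]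
    omega

theorem IsReflection.apply_apply {t : SignedPerm n} (h : IsReflection t) (x : Pt n) :
    t.1 (t.1 x) = x := by
  rcases h with ⟨a, h⟩ | ⟨a, b, hab, h⟩
  · rw [h, Equiv.swap_apply_self]
  · have h1 : a ≠ b := fun h => hab (by rw [h])
    have h2 : a ≠ -b := fun h => hab (by rw [h, coe_neg_pt, abs_neg])
    have h3 : b ≠ -a := fun h => hab (by rw [h, coe_neg_pt, abs_neg])
    have h4 : -a ≠ -b := fun h => h1 (neg_inj_pt.mp h)
    have h5 := neg_ne_self_pt a
    have h6 := neg_ne_self_pt b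
    rw [h, swap_mul_swap_apply hab, swap_mul_swap_apply hab]
    split_ifs <;> simp only [ne_eq, eq_iff_coe, coe_neg_pt, not_true_eq_false] at * <;> omega

theorem IsReflection.mul_self {t : SignedPerm n} (h : IsReflection t) : t * t = 1 :=
  Subtype.ext (Equiv.ext fun x => h.apply_apply x)

theorem IsReflection.pos_eq {t : SignedPerm n} (h : IsReflection t) (x : Pt n) :
    pos t x = t.1 x := by
  apply t.1.injective
  rw [apply_pos, h.apply_apply]

/-- A reflection is determined by one point that it moves together with its image. -/
theorem IsReflection.coe_eq {t : SignedPerm n} (h : IsReflection t) {x y : Pt n} (hxy : x ≠ y)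
    (hx : t.1 x = y) :
    t.1 = if y = -x then Equiv.swap x y else Equiv.swap x y * Equiv.swap (-x) (-y) := by
  rcases h with ⟨a, h⟩ | ⟨a, b, hab, h⟩
  · rw [h, Equiv.swap_apply_def] at hx
    split_ifs at hx with h1 h2
    · subst h1 hx
      simp [h]
    · subst h2 hx
      simp [h, neg_neg_pt, Equiv.swap_comm]
    · exact absurd hx hxy
  · have h1 : a ≠ b := fun h => hab (by rw [h])
    have h2 : a ≠ -b := fun h => hab (by rw [h, coe_neg_pt, abs_neg])
    have h3 : b ≠ -a := fun h => hab (by rw [h, coe_neg_pt, abs_neg])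
    have h4 : -a ≠ -b := fun h => h1 (neg_inj_pt.mp h)
    have hc : Equiv.swap a b * Equiv.swap (-a) (-b) = Equiv.swap (-a) (-b) * Equiv.swap a b := by
      ext1 x
      have h5 := neg_ne_self_pt a
      have h6 := neg_ne_self_pt b
      rw [swap_mul_swap_apply hab, Equiv.Perm.mul_apply]
      simp only [Equiv.swap_apply_def]
      split_ifs <;> simp only [ne_eq, eq_iff_coe, coe_neg_pt] at * <;> omega
    rw [h, swap_mul_swap_apply hab] at hx
    split_ifs at hx with g1 g2 g3 g4
    · subst g1 hx
      rw [if_neg h3, h]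
    · subst g2 hx
      rw [if_neg h2, h, Equiv.swap_comm, Equiv.swap_comm (-a)]
    · subst g3 hx
      rw [if_neg (by rw [neg_neg_pt]; exact h2.symm), neg_neg_pt, neg_neg_pt, h, hc]
    · subst g4 hx
      rw [if_neg (by rw [neg_neg_pt]; exact h3.symm), neg_neg_pt, neg_neg_pt, h, hc,
        Equiv.swap_comm, Equiv.swap_comm a]
    · exact absurd hx hxy

theorem IsReflection.eq_of_apply_eq {s t : SignedPerm n} (hs : IsReflection s)
    (ht : IsReflection t) {x : Pt n} (hx : s.1 x ≠ x) (h : s.1 x = t.1 x) : s = t := by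
  apply Subtype.ext
  rw [hs.coe_eq hx.symm rfl, ht.coe_eq (h ▸ hx.symm) rfl, h]

theorem exists_isReflection {a b : Pt n} (hab : a ≠ b) :
    ∃ t : SignedPerm n, IsReflection t ∧ t.1 a = b := by
  by_cases h : |a.1| = |b.1|
  · have hb : b = -a := by
      rcases abs_eq_abs.mp h with h1 | h1
      · exact absurd (Subtype.ext h1) hab
      · rw [eq_iff_coe, coe_neg_pt]
        omega
    subst hb
    refine ⟨⟨Equiv.swap a (-a), fun x => ?_⟩, Or.inl ⟨a, rfl⟩, Equiv.swap_apply_left _ _⟩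
    have h5 := neg_ne_self_pt a
    have h6 : -x = a ↔ x = -a := by
      rw [← neg_inj_pt, neg_neg_pt]
    have h7 : -x = -a ↔ x = a := neg_inj_pt
    simp only [Equiv.swap_apply_def, h6, h7]
    split_ifs <;> simp only [ne_eq, eq_iff_coe, coe_neg_pt] at * <;> omega
  · refine ⟨⟨Equiv.swap a b * Equiv.swap (-a) (-b), fun x => ?_⟩, Or.inr ⟨a, b, h, rfl⟩, ?_⟩
    · have h1 : a ≠ b := hab
      have h2 : a ≠ -b := fun g => h (by rw [g, coe_neg_pt, abs_neg])
      have h3 : b ≠ -a := fun g => h (by rw [g, coe_neg_pt, abs_neg])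
      have h5 := neg_ne_self_pt a
      have h6 := neg_ne_self_pt b
      have g1 : -x = a ↔ x = -a := by rw [← neg_inj_pt, neg_neg_pt]
      have g2 : -x = b ↔ x = -b := by rw [← neg_inj_pt, neg_neg_pt]
      have h4 : -a ≠ -b := fun h => h1 (neg_inj_pt.mp h)
      rw [swap_mul_swap_apply h, swap_mul_swap_apply h]
      simp only [neg_inj_pt, g1, g2]
      split_ifs <;> simp only [ne_eq, eq_iff_coe, coe_neg_pt] at * <;> omega
    · rw [swap_mul_swap_apply h, if_pos rfl]

theorem IsReflection.conj {s t : SignedPerm n} (hs : IsReflection s) (ht : IsReflection t) :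
    IsReflection (s * t * s) := by
  have hs1 : s⁻¹ = s := inv_eq_of_mul_eq_one_left hs.mul_self
  have hs2 : s.1⁻¹ = s.1 := congrArg Subtype.val hs1
  have key : ∀ a b : Pt n, s.1 * Equiv.swap a b * s.1 = Equiv.swap (s.1 a) (s.1 b) := by
    intro a b
    rw [Equiv.swap_apply_apply, hs2]
  have hss : s.1 * s.1 = 1 := congrArg Subtype.val hs.mul_self
  rcases ht with ⟨a, h⟩ | ⟨a, b, hab, h⟩
  · refine Or.inl ⟨s.1 a, ?_⟩
    change s.1 * t.1 * s.1 = _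
    rw [h, key, apply_neg]
  · refine Or.inr ⟨s.1 a, s.1 b, ?_, ?_⟩
    · intro h'
      rcases abs_eq_abs.mp h' with h1 | h1
      · exact hab (by rw [s.1.injective (Subtype.ext h1)])
      · have : s.1 a = s.1 (-b) := by
          rw [apply_neg, eq_iff_coe, coe_neg_pt, h1]
        rw [s.1.injective this, coe_neg_pt, abs_neg] at hab
        exact hab rfl
    · change s.1 * t.1 * s.1 = _
      rw [h, ← apply_neg, ← apply_neg, ← key, ← key]
      calc s.1 * (Equiv.swap a b * Equiv.swap (-a) (-b)) * s.1
          = s.1 * Equiv.swap a b * 1 * Equiv.swap (-a) (-b) * s.1 := by group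
        _ = _ := by rw [← hss]; simp only [mul_assoc]

/-! ### Simple reflections -/

/-- There is no point 0, so the adjacent positions -1 and 1 give `s₀`; two adjacent negative
positions are replaced by their mirror images. -/
theorem exists_isSimpleReflection {i i' : Pt n} (h : i ⋖ i') :
    ∃ s : SignedPerm n, IsSimpleReflection s ∧ s.1 i = i' := by
  obtain ⟨s, hs, hsi⟩ := exists_isReflection h.lt.ne
  refine ⟨s, ?_, hsi⟩
  have hlt := lt_iff_coe.mp h.lt
  have hadj : ∀ z : ℤ, z ≠ 0 → i.1 < z → z < i'.1 → False := by
    intro z hz h1 h2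
    have hi := abs_le.mp i.2.2
    have hi' := abs_le.mp i'.2.2
    exact h.2 (c := ⟨z, hz, abs_le.mpr ⟨by omega, by omega⟩⟩) h1 h2
  have hi0 := i.2.1
  have hi'0 := i'.2.1
  have hc := hs.coe_eq h.lt.ne hsi
  by_cases h1 : i.1 = -1
  · have h2 : i'.1 = 1 := by
      by_contra h3
      by_cases h4 : 0 < i'.1
      · exact hadj 1 (by norm_num) (by omega) (by omega)
      · omega
    have h3 : i = -i' := by rw [eq_iff_coe, coe_neg_pt]; omega
    refine Or.inl ⟨i', h2, ?_⟩
    rw [hc, if_pos (by rw [h3, neg_neg_pt]), Equiv.swap_comm, h3]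
  · have h2 : i'.1 = i.1 + 1 := by
      by_contra h3
      exact hadj (i.1 + 1) (by omega) (by omega) (by omega)
    have h3 : i' ≠ -i := by
      intro h4
      rw [eq_iff_coe, coe_neg_pt] at h4
      omega
    rw [if_neg h3] at hc
    by_cases h4 : 0 < i.1
    · exact Or.inr ⟨i, i', h4, h2, hc⟩
    · refine Or.inr ⟨-i', -i, ?_, ?_, ?_⟩
      · rw [coe_neg_pt]; omega
      · rw [coe_neg_pt, coe_neg_pt]; omega
      · have hsn : s.1 (-i') = -i := by
          rw [apply_neg, ← hsi, hs.apply_apply]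
        have hne : -i' ≠ -i := fun g => h.lt.ne (neg_inj_pt.mp g).symm
        rw [hs.coe_eq hne hsn, if_neg]
        rw [neg_inj_pt]
        exact fun g => h3 (by rw [g, neg_neg_pt])

/-- Simple reflections reverse the order only of points that they exchange. This drives both the
effect of undoing a descent and the exchange property. -/
theorem IsSimpleReflection.apply_eq_of_lt {s : SignedPerm n} (hs : IsSimpleReflection s)
    {x y : Pt n} (hxy : x < y) (h : s.1 y < s.1 x) : s.1 x = y := by
  rcases hs with ⟨a, ha, hs⟩ | ⟨a, b, ha, hb, hs⟩
  · have hx := x.2.1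
    have hy := y.2.1
    rw [hs] at h ⊢
    simp only [Equiv.swap_apply_def] at h ⊢
    split_ifs at h ⊢ <;> simp only [eq_iff_coe, lt_iff_coe, coe_neg_pt] at * <;> omega
  · have hx := x.2.1
    have hy := y.2.1
    have hab : |a.1| ≠ |b.1| := by
      rw [abs_of_pos ha, abs_of_pos (by omega)]
      omega
    rw [hs] at h ⊢
    rw [swap_mul_swap_apply hab] at h ⊢
    rw [swap_mul_swap_apply hab] at h
    split_ifs at h ⊢ <;> simp only [eq_iff_coe, lt_iff_coe, coe_neg_pt] at * <;> omega

theorem IsSimpleReflection.eq_or_eq_of_lt {s : SignedPerm n} (hs : IsSimpleReflection s)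
    {i i' x y : Pt n} (hii : i < i') (hi : s.1 i = i') (hxy : x < y) (hx : s.1 x = y) :
    (x = i ∧ y = i') ∨ (x = -i' ∧ y = -i) := by
  have hx0 := x.2.1
  have hi0 := i.2.1
  rcases hs with ⟨a, ha, hs⟩ | ⟨a, b, ha, hb, hs⟩
  · rw [hs, Equiv.swap_apply_def] at hx hi
    split_ifs at hx hi <;> simp only [eq_iff_coe, lt_iff_coe, coe_neg_pt] at * <;> omega
  · have hab : |a.1| ≠ |b.1| := by
      rw [abs_of_pos ha, abs_of_pos (by omega)]
      omega
    rw [hs, swap_mul_swap_apply hab] at hx hi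
    split_ifs at hx hi <;> simp only [eq_iff_coe, lt_iff_coe, coe_neg_pt] at * <;> omega

/-- Multiplying by the simple reflection of a descent removes exactly the inversions of this
descent and of its mirror image. -/
theorem inv_mul_simple_iff {π s : SignedPerm n} (hs : IsSimpleReflection s) {p q : Pt n}
    (hpq : Inv π p q) (hsq : s.1 (pos π q) = pos π p) (a b : Pt n) :
    Inv (π * s) a b ↔ Inv π a b ∧ ¬ (a = p ∧ b = q) ∧ ¬ (a = -q ∧ b = -p) := by
  have hr := hs.isReflection
  have hsp : s.1 (pos π p) = pos π q := by rw [← hsq, hr.apply_apply]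
  unfold Inv
  rw [pos_mul, pos_mul, hr.pos_eq, hr.pos_eq]
  constructor
  · rintro ⟨hab, h⟩
    have hlt : pos π b < pos π a := by
      rcases lt_trichotomy (pos π b) (pos π a) with h1 | h1 | h1
      · exact h1
      · exact absurd (pos_inj.mp h1).symm hab.ne
      · have h2 := hs.apply_eq_of_lt h1 h
        rcases hs.eq_or_eq_of_lt hpq.2 hsq h1 h2 with ⟨h3, h4⟩ | ⟨h3, h4⟩
        · rw [pos_inj] at h3 h4
          subst h3 h4
          exact absurd hab hpq.1.asymm
        · rw [← pos_neg, pos_inj] at h3 h4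
          subst h3 h4
          exact absurd (neg_lt_neg_pt_iff.mp hab) hpq.1.asymm
    refine ⟨⟨hab, hlt⟩, ?_, ?_⟩
    · rintro ⟨rfl, rfl⟩
      rw [hsp, hsq] at h
      exact h.asymm hlt
    · rintro ⟨rfl, rfl⟩
      rw [pos_neg, pos_neg, apply_neg, apply_neg, hsp, hsq, neg_lt_neg_pt_iff] at h
      exact h.asymm hpq.2
  · rintro ⟨⟨hab, hlt⟩, h1, h2⟩
    refine ⟨hab, ?_⟩
    rcases lt_trichotomy (s.1 (pos π b)) (s.1 (pos π a)) with h3 | h3 | h3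
    · exact h3
    · exact absurd (pos_inj.mp (s.1.injective h3)).symm hab.ne
    · exfalso
      rcases hs.eq_or_eq_of_lt hpq.2 hsq hlt (hs.apply_eq_of_lt hlt h3) with ⟨h4, h5⟩ | ⟨h4, h5⟩
      · exact h1 ⟨pos_inj.mp h5, pos_inj.mp h4⟩
      · rw [← pos_neg, pos_inj] at h4 h5
        exact h2 ⟨h5, h4⟩

/-! ### Length and the weak order -/

theorem exists_descent {π : SignedPerm n} (hπ : π ≠ 1) :
    ∃ i i' : Pt n, i ⋖ i' ∧ π.1 i' < π.1 i := by
  classical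
  by_contra! h
  let _ : Fintype (Pt n) := Fintype.ofFinite _
  let _ : LocallyFiniteOrder (Pt n) := Fintype.toLocallyFiniteOrder
  have hm : StrictMono π.1 :=
    ((monotone_iff_forall_covBy _).mpr fun a b hab => h a b hab).strictMono_of_injective
      π.1.injective
  have hr : Set.range π.1 = Set.range (id : Pt n → Pt n) := by
    rw [Set.range_id, π.1.surjective.range_eq]
  have he := (StrictMono.range_inj hm strictMono_id).mp hr
  exact hπ (Subtype.ext (Equiv.ext fun x => congrFun he x))

/-- Sorting: each descent undone lowers the number of inverted pairs. Thus the infimum defining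
`coxLength` is attained and is never the default value of an empty set. -/
theorem exists_simple_word (π : SignedPerm n) :
    ∃ l : List (SignedPerm n), (∀ s ∈ l, IsSimpleReflection s) ∧ l.prod = π := by
  have hfin : ∀ π : SignedPerm n, {c : Pt n × Pt n | Inv π c.1 c.2}.Finite :=
    fun π => Set.toFinite _
  induction hk : {c : Pt n × Pt n | Inv π c.1 c.2}.ncard using Nat.strong_induction_on
    generalizing π with
  | _ k ih =>
    by_cases hπ : π = 1
    · exact ⟨[], by simp, by simp [hπ]⟩
    · obtain ⟨i, i', hii, hd⟩ := exists_descent hπ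
      obtain ⟨s, hs, hsi⟩ := exists_isSimpleReflection hii
      have hI : Inv π (π.1 i') (π.1 i) := ⟨hd, by simpa using hii.lt⟩
      have key := inv_mul_simple_iff hs hI (by simpa using hsi)
      have hlt : {c : Pt n × Pt n | Inv (π * s) c.1 c.2}.ncard < k := by
        rw [← hk]
        refine Set.ncard_lt_ncard ⟨fun c hc => ((key _ _).mp hc).1, fun hsub => ?_⟩ (hfin π)
        exact ((key _ _).mp (hsub (a := (π.1 i', π.1 i)) hI)).2.1 ⟨rfl, rfl⟩
      obtain ⟨l, hl, hp⟩ := ih _ hlt (π * s) rfl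
      refine ⟨l ++ [s], ?_, ?_⟩
      · intro r hr
        rcases List.mem_append.mp hr with h | h
        · exact hl r h
        · rwa [List.mem_singleton.mp h]
      · rw [List.prod_append, hp, List.prod_singleton, mul_assoc, hs.isReflection.mul_self, mul_one]

theorem coxLength_le {l : List (SignedPerm n)} (hl : ∀ s ∈ l, IsSimpleReflection s) :
    coxLength l.prod ≤ l.length := Nat.sInf_le ⟨l, rfl, hl, rfl⟩

theorem exists_reduced_word (π : SignedPerm n) :
    ∃ l : List (SignedPerm n), l.length = coxLength π ∧ (∀ s ∈ l, IsSimpleReflection s) ∧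
      l.prod = π := by
  obtain ⟨l, hl, hp⟩ := exists_simple_word π
  exact Nat.sInf_mem (s := {k | ∃ l : List (SignedPerm n), l.length = k ∧
    (∀ s ∈ l, IsSimpleReflection s) ∧ l.prod = π}) ⟨l.length, l, rfl, hl, hp⟩

/-- The strong exchange property. -/
theorem exchange (l : List (SignedPerm n)) (hl : ∀ s ∈ l, IsSimpleReflection s)
    {t : SignedPerm n} (ht : IsReflection t) {a : Pt n} (ha : Inv l.prod a (t.1 a)) :
    ∃ l' : List (SignedPerm n), l'.length < l.length ∧ (∀ s ∈ l', IsSimpleReflection s) ∧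
      l'.prod = t * l.prod := by
  induction l generalizing t a with
  | nil => exact absurd ha.1 (lt_asymm ha.2)
  | cons s w ih =>
    have hs : IsSimpleReflection s := hl s (by simp)
    have hr := hs.isReflection
    have hw : ∀ r ∈ w, IsSimpleReflection r := fun r h => hl r (by simp [h])
    have hta : t.1 a ≠ a := ha.1.ne'
    rcases lt_trichotomy (s.1 a) (s.1 (t.1 a)) with h | h | h
    -- If `s` keeps the order of `a` and `t a`, the images under `s` are inverted in the shorter
    -- word, and `s * t * s` is the reflection relating them.
    · have hc := hr.conj ht
      have ha' : Inv w.prod (s.1 a) ((s * t * s).1 (s.1 a)) := by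
        rw [mul_apply_pt, mul_apply_pt, hr.apply_apply]
        refine ⟨h, ?_⟩
        have := ha.2
        rwa [List.prod_cons, pos_mul, pos_mul, hr.pos_eq, hr.pos_eq] at this
      obtain ⟨l', h1, h2, h3⟩ := ih hw hc ha'
      refine ⟨s :: l', by simpa using h1, ?_, ?_⟩
      · intro r hr'
        rcases List.mem_cons.mp hr' with rfl | h4
        · exact hs
        · exact h2 r h4
      · rw [List.prod_cons, List.prod_cons, h3, ← mul_assoc, ← mul_assoc, ← mul_assoc,
          hr.mul_self, one_mul, mul_assoc]
    · exact absurd (s.1.injective h).symm hta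
    · have hst : s = t := hr.eq_of_apply_eq ht (x := a)
        (by rw [hs.apply_eq_of_lt ha.1 h]; exact hta) (hs.apply_eq_of_lt ha.1 h)
      refine ⟨w, by simp, hw, ?_⟩
      rw [List.prod_cons, ← hst, ← mul_assoc, hr.mul_self, one_mul]

theorem coxLength_mul_lt {w t : SignedPerm n} (ht : IsReflection t) {a : Pt n}
    (ha : Inv w a (t.1 a)) : coxLength (t * w) < coxLength w := by
  obtain ⟨l, h1, h2, h3⟩ := exists_reduced_word w
  subst h3
  obtain ⟨l', h4, h5, h6⟩ := exchange l h2 ht ha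
  rw [← h6, ← h1]
  exact (coxLength_le h5).trans_lt h4

theorem coxLength_mul_lt_iff {w t : SignedPerm n} (ht : IsReflection t) {a : Pt n}
    (ha : a < t.1 a) : coxLength (t * w) < coxLength w ↔ Inv w a (t.1 a) := by
  refine ⟨fun h => ?_, coxLength_mul_lt ht⟩
  by_contra hn
  -- A pair not inverted in `w` is inverted in `t * w`, so multiplying by `t` again would shorten,
  -- the opposite of the assumption.
  have h1 : Inv (t * w) a (t.1 a) := by
    refine ⟨ha, ?_⟩
    rw [pos_mul, pos_mul, ht.pos_eq, ht.pos_eq, ht.apply_apply]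
    exact pos_lt_of_not_inv ha hn
  have h2 := coxLength_mul_lt ht h1
  rw [← mul_assoc, ht.mul_self, one_mul] at h2
  exact h.asymm h2

theorem weak_le_iff {u w : SignedPerm n} : u ≤ w ↔ ∀ a b, Inv u a b → Inv w a b := by
  change inversions u ⊆ inversions w ↔ _
  constructor
  · intro h a b hab
    obtain ⟨t, ht, hta⟩ := exists_isReflection hab.1.ne
    subst hta
    exact (coxLength_mul_lt_iff ht hab.1).mp (h ⟨ht, (coxLength_mul_lt_iff ht hab.1).mpr hab⟩).2
  · rintro h t ⟨ht, hlt⟩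
    obtain ⟨a, ha⟩ : ∃ a, a < t.1 a := by
      by_contra! hn
      have h1 : t = 1 := by
        refine Subtype.ext (Equiv.ext fun x => le_antisymm (hn x) ?_)
        have := hn (t.1 x)
        rwa [ht.apply_apply] at this
      rw [h1, one_mul] at hlt
      exact lt_irrefl _ hlt
    exact ⟨ht, (coxLength_mul_lt_iff ht ha).mpr (h _ _ ((coxLength_mul_lt_iff ht ha).mp hlt))⟩

theorem weak_le_antisymm {u w : SignedPerm n} (h : u ≤ w) (h' : w ≤ u) : u = w :=
  eq_of_inv_iff fun a b => ⟨weak_le_iff.mp h a b, weak_le_iff.mp h' a b⟩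

/-! ### Arc diagrams and inversions -/

theorem Arc.neg_lower (α : Arc n) : (-α).lower = -α.upper := rfl

theorem Arc.neg_upper (α : Arc n) : (-α).upper = -α.lower := rfl

theorem Arc.mem_neg_right {α : Arc n} {x : Pt n} : x ∈ (-α).right ↔ -x ∈ α.left := Iff.rfl

theorem Arc.mem_left {α : Arc n} {x : Pt n} :
    x ∈ α.left ↔ α.lower < x ∧ x < α.upper ∧ x ∉ α.right :=
  ⟨fun h => ⟨h.1.1, h.1.2, h.2⟩, fun h => ⟨⟨h.1, h.2.1⟩, h.2.2⟩⟩

theorem Arc.mem_neg_left {α : Arc n} {x : Pt n} : x ∈ (-α).left ↔ -x ∈ α.right := by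
  have h1 : -α.upper < x ↔ -x < α.upper := by rw [← neg_lt_neg_pt_iff, neg_neg_pt]
  have h2 : x < -α.lower ↔ α.lower < -x := by rw [← neg_lt_neg_pt_iff, neg_neg_pt]
  rw [Arc.mem_left, Arc.mem_neg_right, Arc.neg_lower, Arc.neg_upper, h1, h2, Arc.mem_left]
  constructor
  · rintro ⟨h3, h4, h5⟩
    by_contra h6
    exact h5 ⟨h4, h3, h6⟩
  · intro h
    exact ⟨(α.right_subset h).2, (α.right_subset h).1, fun h6 => h6.2.2 h⟩

theorem Arc.neg_neg (α : Arc n) : - -α = α := by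
  ext1
  · exact neg_neg_pt _
  · exact neg_neg_pt _
  · ext x
    rw [Arc.mem_neg_right, Arc.mem_neg_left, neg_neg_pt]

theorem mem_delta_iff {π : SignedPerm n} {α : Arc n} :
    α ∈ delta π ↔ pos π α.upper ⋖ pos π α.lower ∧
      α.right = {x | α.lower < x ∧ x < α.upper ∧ pos π α.lower < pos π x} := by
  constructor
  · rintro ⟨i, i', h, h1, h2, h3⟩
    rw [h1, h2, h3, pos_apply, pos_apply]
    refine ⟨h, ?_⟩
    ext x
    constructor
    · rintro ⟨h4, h5, k, h6, rfl⟩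
      exact ⟨h4, h5, by rwa [pos_apply]⟩
    · rintro ⟨h4, h5, h6⟩
      exact ⟨h4, h5, _, h6, apply_pos _ _⟩
  · rintro ⟨h, h3⟩
    refine ⟨_, _, h, (apply_pos _ _).symm, (apply_pos _ _).symm, ?_⟩
    rw [h3, apply_pos, apply_pos]
    ext x
    constructor
    · rintro ⟨h4, h5, h6⟩
      exact ⟨h4, h5, _, h6, apply_pos _ _⟩
    · rintro ⟨h4, h5, k, h6, rfl⟩
      exact ⟨h4, h5, by rwa [pos_apply]⟩

theorem pos_lt_of_mem_right {π : SignedPerm n} {α : Arc n} (hα : α ∈ delta π) {x : Pt n}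
    (hx : x ∈ α.right) : pos π α.lower < pos π x := by
  rw [(mem_delta_iff.mp hα).2] at hx
  exact hx.2.2

theorem pos_lt_of_mem_left {π : SignedPerm n} {α : Arc n} (hα : α ∈ delta π) {x : Pt n}
    (hx : x ∈ α.left) : pos π x < pos π α.upper := by
  have hc := (mem_delta_iff.mp hα).1
  have h1 := Arc.mem_left.mp hx
  rw [(mem_delta_iff.mp hα).2] at h1
  by_contra h
  have h2 : pos π α.upper < pos π x :=
    lt_of_le_of_ne (not_lt.mp h) fun g => h1.2.1.ne (pos_inj.mp g).symm
  have h3 : pos π α.lower < pos π x :=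
    lt_of_le_of_ne (not_lt.mp (hc.2 h2)) fun g => h1.1.ne (pos_inj.mp g)
  exact h1.2.2 ⟨h1.1, h1.2.1, h3⟩

theorem inv_of_mem_delta {π : SignedPerm n} {α : Arc n} (hα : α ∈ delta π) :
    Inv π α.lower α.upper := ⟨α.lower_lt_upper, (mem_delta_iff.mp hα).1.lt⟩

/-- The pairs of values inverted by the permutation (without signs) of the single arc `α`. -/
def Arc.Inverts (α : Arc n) (a b : Pt n) : Prop :=
  a < b ∧ (b ∈ α.left ∨ b = α.upper) ∧ (a ∈ α.right ∨ a = α.lower)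

theorem Arc.Inverts.neg {α : Arc n} {a b : Pt n} (h : α.Inverts a b) :
    (-α).Inverts (-b) (-a) := by
  refine ⟨neg_lt_neg_pt h.1, ?_, ?_⟩
  · rw [Arc.mem_neg_left, neg_neg_pt, Arc.neg_upper, neg_inj_pt]
    exact h.2.2
  · rw [Arc.mem_neg_right, neg_neg_pt, Arc.neg_lower, neg_inj_pt]
    exact h.2.1

/-- If `α` is an arc of `π` and `y ≤ π` inverts the endpoints of `α`, then `y` inverts everything
that is inverted by `α`. -/
theorem Arc.Inverts.inv_of_le {π y : SignedPerm n} (hy : y ≤ π) {α : Arc n} (hα : α ∈ delta π)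
    (h : Inv y α.lower α.upper) {a b : Pt n} (hab : α.Inverts a b) : Inv y a b := by
  obtain ⟨hlt, hb, ha⟩ := hab
  refine ⟨hlt, ?_⟩
  have h1 : pos y b ≤ pos y α.upper := by
    rcases hb with hb | rfl
    · refine (pos_lt_of_not_inv (Arc.mem_left.mp hb).2.1 fun hn => ?_).le
      exact (pos_lt_of_mem_left hα hb).asymm (weak_le_iff.mp hy _ _ hn).2
    · exact le_rfl
  have h2 : pos y α.lower ≤ pos y a := by
    rcases ha with ha | rfl
    · refine (pos_lt_of_not_inv (α.right_subset ha).1 fun hn => ?_).le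
      exact (pos_lt_of_mem_right hα ha).asymm (weak_le_iff.mp hy _ _ hn).2
    · exact le_rfl
  exact h1.trans_lt (h.2.trans_le h2)

theorem Arc.Inverts.inv {π : SignedPerm n} {α : Arc n} (hα : α ∈ delta π) {a b : Pt n}
    (hab : α.Inverts a b) : Inv π a b := hab.inv_of_le le_rfl hα (inv_of_mem_delta hα)

theorem exists_mem_delta {π : SignedPerm n} {p q : Pt n} (hpq : p < q)
    (h : pos π q ⋖ pos π p) : ∃ α ∈ delta π, α.lower = p ∧ α.upper = q :=
  ⟨⟨p, q, {x | p < x ∧ x < q ∧ pos π p < pos π x}, hpq, fun _ hx => ⟨hx.1, hx.2.1⟩⟩,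
    mem_delta_iff.mpr ⟨h, rfl⟩, rfl, rfl⟩

/-- The inversions of `π` are generated by those of its arcs. -/
theorem Inv.of_arcs {π u : SignedPerm n}
    (hu : ∀ α ∈ delta π, ∀ a b, α.Inverts a b → Inv u a b) {a b : Pt n} (hab : Inv π a b) :
    Inv u a b := by
  classical
  let _ : Fintype (Pt n) := Fintype.ofFinite _
  let _ : LocallyFiniteOrder (Pt n) := Fintype.toLocallyFiniteOrder
  induction hk : ((pos π a).1 - (pos π b).1).toNat using Nat.strong_induction_on
    generalizing a b with
  | _ k ih =>
    have hlt := lt_iff_coe.mp hab.2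
    by_cases hm : ∃ c, a < c ∧ c < b ∧ pos π b < pos π c ∧ pos π c < pos π a
    · obtain ⟨c, h1, h2, h3, h4⟩ := hm
      have h3' := lt_iff_coe.mp h3
      have h4' := lt_iff_coe.mp h4
      exact Inv.trans (ih _ (by omega) ⟨h1, h4⟩ rfl) (ih _ (by omega) ⟨h2, h3⟩ rfl)
    · push Not at hm
      -- No value strictly between `a` and `b` occurs between their positions. Hence, after the last
      -- position `i` before that of `a` with value at least `b`, the next value is at most `a`: the
      -- arc of this descent inverts the pair.
      obtain ⟨i, ⟨hi1, hi2, hi3⟩, himax⟩ := Set.Finite.exists_maximal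
        (s := {i | pos π b ≤ i ∧ i < pos π a ∧ b ≤ π.1 i}) (Set.toFinite _)
        ⟨pos π b, le_rfl, hab.2, by rw [apply_pos]⟩
      obtain ⟨i', hii, hi'⟩ := exists_covBy_le_of_lt hi2
      have hi'a : π.1 i' ≤ a := by
        rcases hi'.eq_or_lt with h | h
        · rw [h, apply_pos]
        · by_contra hc
          have h1 : π.1 i' < b := by
            by_contra hb
            exact hii.lt.not_ge (himax ⟨hi1.trans hii.lt.le, h, not_lt.mp hb⟩ hii.lt.le)
          have := hm _ (not_le.mp hc) h1 (by rw [pos_apply]; exact hi1.trans_lt hii.lt)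
          rw [pos_apply] at this
          exact this.not_gt h
      obtain ⟨α, hα, hl, hr⟩ := exists_mem_delta (π := π) (p := π.1 i') (q := π.1 i)
        (hi'a.trans_lt (hab.1.trans_le hi3)) (by rwa [pos_apply, pos_apply])
      refine hu α hα a b ⟨hab.1, ?_, ?_⟩
      · rcases hi3.eq_or_lt with h | h
        · exact Or.inr (by rw [hr, h])
        · refine Or.inl (Arc.mem_left.mpr ⟨?_, ?_, fun hn => ?_⟩)
          · rw [hl]; exact hi'a.trans_lt hab.1
          · rw [hr]; exact h
          · have := pos_lt_of_mem_right hα hn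
            rw [hl, pos_apply] at this
            exact (hi1.trans_lt hii.lt).asymm this
      · rcases hi'a.eq_or_lt with h | h
        · exact Or.inr (by rw [hl, h])
        · rw [(mem_delta_iff.mp hα).2, hl, hr]
          refine Or.inl ⟨h, hab.1.trans_le hi3, ?_⟩
          rw [pos_apply]
          refine lt_of_le_of_ne hi' fun g => h.ne ?_
          rw [g, apply_pos]

theorem le_of_arcs {π u : SignedPerm n}
    (hu : ∀ α ∈ delta π, ∀ a b, α.Inverts a b → Inv u a b) : π ≤ u :=
  weak_le_iff.mpr fun _ _ => Inv.of_arcs hu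

theorem delta_injective : Function.Injective (delta (n := n)) := by
  intro u w h
  refine weak_le_antisymm (le_of_arcs fun α hα a b hab => ?_) (le_of_arcs fun α hα a b hab => ?_)
  · exact hab.inv (h ▸ hα)
  · exact hab.inv (h ▸ hα)

theorem neg_mem_delta {π : SignedPerm n} {α : Arc n} (hα : α ∈ delta π) : -α ∈ delta π := by
  have hc := (mem_delta_iff.mp hα).1
  rw [mem_delta_iff, Arc.neg_upper, Arc.neg_lower, pos_neg, pos_neg]
  refine ⟨⟨neg_lt_neg_pt hc.lt, fun z h1 h2 => hc.2 (c := -z) ?_ ?_⟩, ?_⟩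
  · rwa [← neg_lt_neg_pt_iff, neg_neg_pt]
  · rwa [← neg_lt_neg_pt_iff, neg_neg_pt]
  · ext x
    rw [Arc.mem_neg_right]
    constructor
    · intro h
      have h1 := Arc.mem_left.mp h
      refine ⟨?_, ?_, ?_⟩
      · rw [← neg_lt_neg_pt_iff, neg_neg_pt]; exact h1.2.1
      · rw [← neg_lt_neg_pt_iff, neg_neg_pt]; exact h1.1
      · rw [← neg_lt_neg_pt_iff, neg_neg_pt, ← pos_neg]
        exact pos_lt_of_mem_left hα h
    · rintro ⟨h1, h2, h3⟩
      rw [← neg_lt_neg_pt_iff, neg_neg_pt] at h1 h2 h3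
      rw [← pos_neg] at h3
      exact Arc.mem_left.mpr ⟨h2, h1, fun h4 =>
        (pos_lt_of_mem_right hα h4).asymm (h3.trans hc.lt)⟩

/-! ### Compatibility of the arcs of a diagram -/

theorem eq_of_upper_eq {π : SignedPerm n} {α β : Arc n} (hα : α ∈ delta π) (hβ : β ∈ delta π)
    (h : α.upper = β.upper) : α = β := by
  have h1 := mem_delta_iff.mp hα
  have h2 := mem_delta_iff.mp hβ
  have h3 : α.lower = β.lower := pos_inj.mp (h1.1.unique_right (h ▸ h2.1))
  ext1
  · exact h3
  · exact h
  · rw [h1.2, h2.2, h, h3]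

theorem eq_of_lower_eq {π : SignedPerm n} {α β : Arc n} (hα : α ∈ delta π) (hβ : β ∈ delta π)
    (h : α.lower = β.lower) : α = β := by
  have h1 := mem_delta_iff.mp hα
  have h2 := mem_delta_iff.mp hβ
  exact eq_of_upper_eq hα hβ (pos_inj.mp (h1.1.unique_left (h ▸ h2.1)))

/-- A point at or left of `α` occurs no later than `α.lower`, and a point at or right of `β` no
earlier than `β.upper`. Since the descent of `α` comes first, a point of both kinds must be an
endpoint of both arcs. -/
theorem not_rightAt_of_pos_lt {π : SignedPerm n} {α β : Arc n} (hα : α ∈ delta π)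
    (hβ : β ∈ delta π) (h : pos π α.upper < pos π β.upper) (x : Pt n) : ¬ α.RightAt β x := by
  rintro ⟨h1, h2, h3⟩
  have hα' := (mem_delta_iff.mp hα).1
  have hβ' := (mem_delta_iff.mp hβ).1
  have h4 : pos π α.lower ≤ pos π β.upper := not_lt.mp (hα'.2 h)
  have h5 : x ∈ α.left ∨ α.IsEndpoint x → pos π x < pos π α.lower ∨ x = α.lower := by
    rintro (g | g | g)
    · exact Or.inl ((pos_lt_of_mem_left hα g).trans hα'.lt)
    · exact Or.inr g
    · exact Or.inl (g ▸ hα'.lt)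
  have h6 : x ∈ β.right ∨ β.IsEndpoint x → pos π β.upper < pos π x ∨ x = β.upper := by
    rintro (g | g | g)
    · exact Or.inl (hβ'.lt.trans (pos_lt_of_mem_right hβ g))
    · exact Or.inl (g ▸ hβ'.lt)
    · exact Or.inr g
  rcases h5 h1 with g1 | g1 <;> rcases h6 h2 with g2 | g2
  · exact (g1.trans_le h4).asymm g2
  · rw [g2] at g1
    exact g1.not_ge h4
  · rw [g1] at g2
    exact g2.not_ge h4
  · exact h3 ⟨Or.inl g1, Or.inr g2⟩

theorem compatible_of_mem_delta {π : SignedPerm n} {α β : Arc n} (hα : α ∈ delta π)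
    (hβ : β ∈ delta π) (hne : α ≠ β) : α.Compatible β := by
  refine ⟨fun h => hne (eq_of_upper_eq hα hβ h), fun h => hne (eq_of_lower_eq hα hβ h), ?_⟩
  rintro ⟨⟨x, hx⟩, y, hy⟩
  rcases lt_trichotomy (pos π α.upper) (pos π β.upper) with h | h | h
  · exact not_rightAt_of_pos_lt hα hβ h x hx
  · exact hne (eq_of_upper_eq hα hβ (pos_inj.mp h))
  · exact not_rightAt_of_pos_lt hβ hα h y hy

/-! ### Join-irreducible elements and canonical join representations -/

theorem exists_eq_pair {A : Set (Arc n)} (hA : IsSymmetricArc A ∨ IsSymmetricPair A) :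
    ∃ α : Arc n, A = {α, -α} := by
  rcases hA with ⟨α, h, rfl⟩ | ⟨α, -, -, rfl⟩
  · exact ⟨α, by rw [h, Set.pair_eq_singleton]⟩
  · exact ⟨α, rfl⟩

theorem mem_symmetricParts {π : SignedPerm n} {α : Arc n} (hα : α ∈ delta π) :
    {α, -α} ∈ symmetricParts (delta π) := by
  refine ⟨?_, ?_⟩
  · by_cases h : -α = α
    · exact Or.inl ⟨α, h, by rw [h, Set.pair_eq_singleton]⟩
    · exact Or.inr ⟨α, h, compatible_of_mem_delta hα (neg_mem_delta hα) fun g => h g.symm, rfl⟩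
  · rintro β (rfl | rfl)
    · exact hα
    · exact neg_mem_delta hα

theorem le_iff_of_delta_eq {j u : SignedPerm n} {α : Arc n} (hj : delta j = {α, -α}) :
    j ≤ u ↔ ∀ a b, α.Inverts a b → Inv u a b := by
  constructor
  · intro h a b hab
    exact weak_le_iff.mp h _ _ (hab.inv (by rw [hj]; simp))
  · intro h
    refine le_of_arcs fun β hβ a b hab => ?_
    rw [hj] at hβ
    rcases hβ with rfl | rfl
    · exact h a b hab
    · have := (h _ _ (by simpa [Arc.neg_neg] using hab.neg)).neg
      rwa [neg_neg_pt, neg_neg_pt] at this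

theorem le_of_inv {π j y : SignedPerm n} {α : Arc n} (hj : delta j = {α, -α})
    (hα : α ∈ delta π) (hy : y ≤ π) (h : Inv y α.lower α.upper) : j ≤ y :=
  (le_iff_of_delta_eq hj).mpr fun _ _ hab => hab.inv_of_le hy hα h

/-- Undoing the descent of the arc `α` of `π`. -/
theorem exists_lower_cover {π : SignedPerm n} {α : Arc n} (hα : α ∈ delta π) :
    ∃ u : SignedPerm n, ∀ a b, Inv u a b ↔ Inv π a b ∧ ¬ (a = α.lower ∧ b = α.upper) ∧
      ¬ (a = -α.upper ∧ b = -α.lower) := by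
  obtain ⟨s, hs, hsi⟩ := exists_isSimpleReflection (mem_delta_iff.mp hα).1
  exact ⟨π * s, inv_mul_simple_iff hs (inv_of_mem_delta hα) hsi⟩

/-- Undoing the descent removes only the endpoint pair and its mirror image, and by symmetry an
element that does not invert the former does not invert the latter. -/
theorem exists_max_not_inv {π : SignedPerm n} {α : Arc n} (hα : α ∈ delta π) :
    ∃ u : SignedPerm n, u < π ∧ ∀ y ≤ π, ¬ Inv y α.lower α.upper → y ≤ u := by
  obtain ⟨u, key⟩ := exists_lower_cover hα
  refine ⟨u, lt_iff_le_not_ge.mpr ⟨weak_le_iff.mpr fun a b h => ((key a b).mp h).1,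
    fun h => ?_⟩, fun y hy hn => weak_le_iff.mpr fun a b h => (key a b).mpr
      ⟨weak_le_iff.mp hy _ _ h, ?_, ?_⟩⟩
  · exact ((key _ _).mp (weak_le_iff.mp h _ _ (inv_of_mem_delta hα))).2.1 ⟨rfl, rfl⟩
  · rintro ⟨rfl, rfl⟩
    exact hn h
  · rintro ⟨rfl, rfl⟩
    have := h.neg
    rw [neg_neg_pt, neg_neg_pt] at this
    exact hn this

theorem isJoinIrreducible_of_delta_eq {j : SignedPerm n} {α : Arc n} (hj : delta j = {α, -α}) :
    IsJoinIrreducible j := by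
  have hα : α ∈ delta j := by rw [hj]; simp
  obtain ⟨u, hu, h⟩ := exists_max_not_inv hα
  have key : ∀ k < j, k ≤ u := fun k hk =>
    h k hk.le fun hI => hk.not_ge (le_of_inv hj hα hk.le hI)
  refine ⟨u, ⟨hu, fun k h1 h2 => h1.not_ge (key k h2)⟩, fun k hk => ?_⟩
  refine weak_le_antisymm (key k hk.lt) ?_
  by_contra hn
  exact hk.2 (lt_of_le_not_ge (key k hk.lt) hn) hu

/-- The endpoints of `α` occupy adjacent positions, and inverting them places the descent of `β`
between these positions. -/
theorem inverts_endpoints_imp {π : SignedPerm n} {α β : Arc n} (hα : α ∈ delta π)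
    (hβ : β ∈ delta π) (h : β.Inverts α.lower α.upper) : α = β := by
  have hα' := (mem_delta_iff.mp hα).1
  have hβ' := (mem_delta_iff.mp hβ).1
  apply eq_of_upper_eq hα hβ
  rcases h.2.1 with h1 | h1
  · exfalso
    have g1 := pos_lt_of_mem_left hβ h1
    have g2 : pos π β.upper < pos π α.lower := by
      rcases h.2.2 with h2 | h2
      · exact hβ'.lt.trans (pos_lt_of_mem_right hβ h2)
      · exact h2 ▸ hβ'.lt
    exact hα'.2 g1 g2
  · exact h1

/-- If neither `α` nor `-α` were an arc of `j`, no arc of `j` would invert the endpoints of `α`, so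
`j` would stay below the element with that descent undone. This makes the representation an
antichain. -/
theorem mem_delta_of_inv {π j : SignedPerm n} (hj : delta j ⊆ delta π) {α : Arc n}
    (hα : α ∈ delta π) (h : Inv j α.lower α.upper) : α ∈ delta j := by
  by_contra hn
  obtain ⟨u, key⟩ := exists_lower_cover hα
  have hju : j ≤ u := by
    refine le_of_arcs fun β hβ a b hab => (key a b).mpr ⟨hab.inv (hj hβ), ?_, ?_⟩
    · rintro ⟨rfl, rfl⟩
      exact hn (inverts_endpoints_imp hα (hj hβ) hab ▸ hβ)
    · rintro ⟨rfl, rfl⟩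
      have h1 : -α = β := inverts_endpoints_imp (neg_mem_delta hα) (hj hβ) hab
      rw [← Arc.neg_neg α, h1] at hn
      exact hn (neg_mem_delta hβ)
  exact ((key _ _).mp (weak_le_iff.mp hju _ _ h)).2.1 ⟨rfl, rfl⟩

theorem pair_eq_of_mem {α β : Arc n} (h : α ∈ ({β, -β} : Set (Arc n))) :
    ({α, -α} : Set (Arc n)) = {β, -β} := by
  rcases h with rfl | rfl
  · rfl
  · rw [Arc.neg_neg, Set.pair_comm]

theorem isCanonicalJoinRep_of_delta {π : SignedPerm n} {X : Set (SignedPerm n)}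
    (hX : ∀ j ∈ X, ∃ α ∈ delta π, delta j = {α, -α})
    (hX' : ∀ α ∈ delta π, ∃ j ∈ X, delta j = {α, -α}) : IsCanonicalJoinRep π X where
  antichain := by
    intro j hj k hk hne hle
    obtain ⟨α, hα, hjα⟩ := hX j hj
    obtain ⟨β, hβ, hkβ⟩ := hX k hk
    have hαj : α ∈ delta j := by rw [hjα]; simp
    have hsub : delta k ⊆ delta π := by
      rw [hkβ]
      rintro γ (rfl | rfl)
      · exact hβ
      · exact neg_mem_delta hβ
    have h1 := mem_delta_of_inv hsub hα (weak_le_iff.mp hle _ _ (inv_of_mem_delta hαj))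
    rw [hkβ] at h1
    exact hne (delta_injective (by rw [hjα, hkβ, pair_eq_of_mem h1]))
  isLUB := by
    constructor
    · intro j hj
      obtain ⟨α, hα, hjα⟩ := hX j hj
      exact le_of_inv hjα hα le_rfl (inv_of_mem_delta hα)
    · intro u hu
      refine le_of_arcs fun α hα a b hab => ?_
      obtain ⟨j, hj, hjα⟩ := hX' α hα
      exact (le_iff_of_delta_eq hjα).mp (hu hj) a b hab
  minimal := by
    intro X' hX'π k hk
    obtain ⟨j, hj, hkj⟩ := hk
    obtain ⟨α, hα, hjα⟩ := hX j hj
    obtain ⟨u, hu, hmax⟩ := exists_max_not_inv hα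
    by_contra hn
    -- Otherwise no member of `X'` inverts the endpoints of `α`, and `u < π` bounds `X'`.
    refine hu.not_ge (hX'π.2 fun y hy => hmax y (hX'π.1 hy) fun hI => hn ?_)
    exact ⟨y, hy, hkj.trans (le_of_inv hjα hα (hX'π.1 hy) hI)⟩

/-! ### Words and increasing lists -/

theorem mem_increasing {S : Set (Pt n)} {x : Pt n} : x ∈ increasing S ↔ x ∈ S := by
  simp [increasing]

theorem increasing_pairwise (S : Set (Pt n)) : (increasing S).Pairwise (· < ·) :=
  (Finset.sortedLT_sort _).pairwise

/-- Used with `id` for increasing lists and with `pos j` for one-line notations. -/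
theorem eq_of_pairwise_lt {γ : Type*} [Preorder γ] (f : Pt n → γ) {l l' : List (Pt n)}
    (hl : l.Pairwise fun x y => f x < f y) (hl' : l'.Pairwise fun x y => f x < f y)
    (h : ∀ x, x ∈ l ↔ x ∈ l') : l = l' := by
  have hn : ∀ {m : List (Pt n)}, (m.Pairwise fun x y => f x < f y) → m.Nodup :=
    fun hm => hm.imp fun hab hne => hab.ne (congrArg f hne)
  refine List.Perm.eq_of_pairwise (le := fun x y => f x < f y) ?_ hl hl'
    ((List.perm_ext_iff_of_nodup (hn hl) (hn hl')).mpr h)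
  exact fun a b _ _ h1 h2 => absurd h1 h2.asymm

theorem increasing_append {A B : Set (Pt n)} (h : ∀ a ∈ A, ∀ b ∈ B, a < b) :
    increasing A ++ increasing B = increasing (A ∪ B) := by
  refine eq_of_pairwise_lt id ?_ (increasing_pairwise _) ?_
  · refine List.pairwise_append.mpr ⟨increasing_pairwise _, increasing_pairwise _, ?_⟩
    intro a ha b hb
    exact h a (mem_increasing.mp ha) b (mem_increasing.mp hb)
  · intro x
    rw [List.mem_append, mem_increasing, mem_increasing, mem_increasing, Set.mem_union]

theorem increasing_singleton (a : Pt n) : increasing {a} = [a] := by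
  refine eq_of_pairwise_lt id (increasing_pairwise _) (List.pairwise_singleton _ _) fun x => ?_
  rw [mem_increasing, List.mem_singleton, Set.mem_singleton_iff]

theorem increasing_empty : increasing (∅ : Set (Pt n)) = [] :=
  List.eq_nil_iff_forall_not_mem.mpr fun _ hx => (mem_increasing.mp hx).elim

theorem oneLine_injective : Function.Injective (oneLine (n := n)) := by
  intro u w h
  have h1 : ∀ i : Pt n, 0 < i.1 → u.1 i = w.1 i := fun i hi =>
    List.map_inj_left.mp h i (mem_increasing.mpr hi)
  refine Subtype.ext (Equiv.ext fun i => ?_)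
  rcases lt_or_gt_of_ne i.2.1 with hi | hi
  · have := h1 (-i) (by rw [coe_neg_pt]; omega)
    rwa [apply_neg, apply_neg, neg_inj_pt] at this
  · exact h1 i hi

/-- Listing the points in the order of an odd injective key gives a signed permutation. -/
theorem exists_signedPerm_of_key {γ : Type*} [LinearOrder γ] (f : Pt n → γ)
    (hf : Function.Injective f) (hodd : ∀ x y, f x < f y → f (-y) < f (-x)) :
    ∃ π : SignedPerm n, StrictMono fun i => f (π.1 i) := by
  classical
  let _ : Fintype (Pt n) := Fintype.ofFinite _
  let e : Fin (Fintype.card (Pt n)) ≃o Pt n := Fintype.orderIsoFinOfCardEq (Pt n) rfl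
  let σ : Equiv.Perm (Pt n) := e.toEquiv.symm.trans ((Tuple.sort (f ∘ e)).trans e.toEquiv)
  have hσ : StrictMono fun i => f (σ i) := by
    refine Monotone.strictMono_of_injective ?_ (hf.comp σ.injective)
    intro x y hxy
    exact Tuple.monotone_sort (f ∘ e) (e.symm.monotone hxy)
  have hσ' : StrictMono fun i => f (-σ (-i)) := by
    intro x y hxy
    exact hodd _ _ (hσ (neg_lt_neg_pt hxy))
  -- Sorting by `f` and its conjugate by negation are both increasing for `f` with the same range,
  -- so they coincide: the sorting permutation is odd.
  have he := (StrictMono.range_inj hσ hσ').mp (by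
    ext z
    constructor
    · rintro ⟨x, rfl⟩
      exact ⟨-σ.symm (-σ x), by simp [neg_neg_pt]⟩
    · rintro ⟨x, rfl⟩
      exact ⟨σ.symm (-σ (-x)), by simp⟩)
  refine ⟨⟨σ, fun x => ?_⟩, hσ⟩
  have := hf (congrFun he (-x))
  rwa [neg_neg_pt] at this

/-! ### The blocks of a join-irreducible element -/

namespace Arc

/-- The values from the lower endpoint of `α` on, in the permutation of the single arc `α`,
that lie between its endpoints. -/
def low (α : Arc n) : Set (Pt n) := {x | x = α.lower ∨ x ∈ α.right}

/-- The values of the last increasing run of the long one-line notation. -/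
def lastRun (α : Arc n) : Set (Pt n) := {x | x ∈ α.low ∨ (α.upper < x ∧ -x ∉ α.low)}

open Classical in
/-- The index of the increasing run that contains the value `x`. -/
noncomputable def block (α : Arc n) (x : Pt n) : ℤ :=
  if x ∈ α.lastRun then 1 else if -x ∈ α.lastRun then -1 else 0

/-- The positive values of the middle increasing run. -/
def midRun (α : Arc n) : Set (Pt n) := {x | 0 < x.1 ∧ x ∉ α.lastRun ∧ -x ∉ α.lastRun}

/-- The conditions under which the three runs of `α` define a signed permutation with the arcs
`α` and `-α`. -/
structure Admissible (α : Arc n) : Prop where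
  upper_pos : 0 < α.upper.1
  neg_notMem_low : ∀ x ∈ α.low, -x ∉ α.low
  -- A nonsymmetric arc needs its upper endpoint at the end of the middle run, hence outside the
  -- first run.
  neg_upper_notMem_low : -α = α ∨ -α.upper ∉ α.low

theorem lower_le_of_mem_low {α : Arc n} {x : Pt n} (h : x ∈ α.low) : α.lower ≤ x := by
  rcases h with rfl | h
  · exact le_rfl
  · exact (α.right_subset h).1.le

theorem lt_upper_of_mem_low {α : Arc n} {x : Pt n} (h : x ∈ α.low) : x < α.upper := by
  rcases h with rfl | h
  · exact α.lower_lt_upper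
  · exact (α.right_subset h).2

theorem lower_mem_lastRun (α : Arc n) : α.lower ∈ α.lastRun := Or.inl (Or.inl rfl)

theorem lower_le_of_mem_lastRun {α : Arc n} {x : Pt n} (h : x ∈ α.lastRun) : α.lower ≤ x := by
  rcases h with h | h
  · exact lower_le_of_mem_low h
  · exact (α.lower_lt_upper.trans h.1).le

theorem upper_notMem_lastRun (α : Arc n) : α.upper ∉ α.lastRun := by
  rintro (h | h)
  · exact lt_irrefl _ (lt_upper_of_mem_low h)
  · exact lt_irrefl _ h.1

theorem mem_right_iff_of_lt {α : Arc n} {x : Pt n} (h1 : α.lower < x) (h2 : x < α.upper) :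
    x ∈ α.right ↔ x ∈ α.lastRun :=
  ⟨fun h => Or.inl (Or.inr h), fun h => by
    rcases h with (h | h) | h
    · exact absurd h h1.ne'
    · exact h
    · exact absurd h.1 h2.asymm⟩

theorem le_upper_of_notMem {α : Arc n} {x : Pt n} (h1 : x ∉ α.lastRun) (h2 : -x ∉ α.lastRun) :
    x ≤ α.upper := by
  by_contra h
  exact h1 (Or.inr ⟨not_le.mp h, fun h3 => h2 (Or.inl h3)⟩)

theorem block_cases (α : Arc n) (x : Pt n) :
    (x ∈ α.lastRun ∧ α.block x = 1) ∨ (-x ∈ α.lastRun ∧ α.block x = -1) ∨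
      (x ∉ α.lastRun ∧ -x ∉ α.lastRun ∧ α.block x = 0) := by
  unfold block
  by_cases h1 : x ∈ α.lastRun
  · exact Or.inl ⟨h1, if_pos h1⟩
  · by_cases h2 : -x ∈ α.lastRun
    · exact Or.inr (Or.inl ⟨h2, by rw [if_neg h1, if_pos h2]⟩)
    · exact Or.inr (Or.inr ⟨h1, h2, by rw [if_neg h1, if_neg h2]⟩)

theorem block_eq_one_iff {α : Arc n} {x : Pt n} : α.block x = 1 ↔ x ∈ α.lastRun := by
  unfold block
  split_ifs <;> simp_all

theorem block_lower (α : Arc n) : α.block α.lower = 1 :=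
  block_eq_one_iff.mpr α.lower_mem_lastRun

theorem block_upper_ne (α : Arc n) : α.block α.upper ≠ 1 := fun h =>
  α.upper_notMem_lastRun (block_eq_one_iff.mp h)

theorem block_le_one (α : Arc n) (x : Pt n) : α.block x ≤ 1 := by
  rcases α.block_cases x with ⟨-, h⟩ | ⟨-, h⟩ | ⟨-, -, h⟩ <;> omega

theorem pos_lower_le {α : Arc n} {j : SignedPerm n}
    (hj : ∀ x y, pos j x < pos j y ↔ α.block x < α.block y ∨ (α.block x = α.block y ∧ x < y))
    {x : Pt n} (hx : α.block x = 1) : pos j α.lower ≤ pos j x := by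
  have := lower_le_of_mem_lastRun (block_eq_one_iff.mp hx)
  rw [← not_lt, hj, hx, block_lower]
  rw [le_iff_coe] at this
  rw [lt_iff_coe]
  omega

theorem pos_upper_lt {α : Arc n} {j : SignedPerm n}
    (hj : ∀ x y, pos j x < pos j y ↔ α.block x < α.block y ∨ (α.block x = α.block y ∧ x < y)) :
    pos j α.upper < pos j α.lower := by
  rw [hj, block_lower]
  exact Or.inl (lt_of_le_of_ne (α.block_le_one _) α.block_upper_ne)

/-! ### The signed permutation with three increasing runs -/

namespace Admissible

variable {α : Arc n} (h : α.Admissible)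
theorem neg_notMem_lastRun (h : α.Admissible) {x : Pt n} (hx : x ∈ α.lastRun) : -x ∉ α.lastRun := by
  have hq := h.upper_pos
  rintro (h1 | ⟨h1, h1'⟩)
  · rcases hx with h2 | ⟨-, h2⟩
    · exact h.neg_notMem_low _ h2 h1
    · exact h2 h1
  · rw [neg_neg_pt] at h1'
    rcases hx with h2 | ⟨h2, -⟩
    · exact h1' h2
    · rw [lt_iff_coe] at h1 h2
      rw [coe_neg_pt] at h1
      omega

theorem block_neg (h : α.Admissible) (x : Pt n) : α.block (-x) = -α.block x := by
  unfold block
  rw [neg_neg_pt]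
  by_cases h1 : x ∈ α.lastRun
  · rw [if_neg (h.neg_notMem_lastRun h1), if_pos h1, if_pos h1]
  · by_cases h2 : -x ∈ α.lastRun
    · rw [if_pos h2, if_neg h1, if_pos h2, _root_.neg_neg]
    · simp [h1, h2]

theorem exists_signedPerm (h : α.Admissible) : ∃ j : SignedPerm n, ∀ x y, pos j x < pos j y ↔
    α.block x < α.block y ∨ (α.block x = α.block y ∧ x < y) := by
  obtain ⟨j, hj⟩ := exists_signedPerm_of_key (fun x => toLex (α.block x, x))
    (fun x y hxy => (Prod.ext_iff.mp (toLex_inj.mp hxy)).2) (by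
      intro x y hxy
      rw [Prod.Lex.toLex_lt_toLex] at hxy ⊢
      simp only [h.block_neg] at hxy ⊢
      rw [neg_lt_neg_iff, neg_inj, neg_lt_neg_pt_iff]
      exact hxy.imp id fun g => ⟨g.1.symm, g.2⟩)
  refine ⟨j, fun x y => ?_⟩
  have := hj.lt_iff_lt (a := pos j x) (b := pos j y)
  simp only [apply_pos] at this
  rw [← this, Prod.Lex.toLex_lt_toLex]

theorem oneLine_eq (h : α.Admissible) {j : SignedPerm n}
    (hj : ∀ x y, pos j x < pos j y ↔ α.block x < α.block y ∨ (α.block x = α.block y ∧ x < y)) :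
    oneLine j = increasing α.midRun ++ increasing α.lastRun := by
  refine eq_of_pairwise_lt (pos j) ?_ ?_ fun x => ?_
  · refine List.pairwise_map.mpr ((increasing_pairwise _).imp fun hab => ?_)
    rwa [pos_apply, pos_apply]
  · refine List.pairwise_append.mpr ⟨?_, ?_, ?_⟩
    · refine (increasing_pairwise _).imp_of_mem fun {a b} ha hb hab => ?_
      have ha' := mem_increasing.mp ha
      have hb' := mem_increasing.mp hb
      exact (hj a b).mpr (Or.inr ⟨by simp [block, ha'.2.1, ha'.2.2, hb'.2.1, hb'.2.2], hab⟩)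
    · refine (increasing_pairwise _).imp_of_mem fun {a b} ha hb hab => ?_
      rw [mem_increasing, ← block_eq_one_iff] at ha hb
      exact (hj a b).mpr (Or.inr ⟨by rw [ha, hb], hab⟩)
    · intro a ha b hb
      rw [mem_increasing, ← block_eq_one_iff] at hb
      have ha' := mem_increasing.mp ha
      exact (hj a b).mpr (Or.inl (by rw [hb]; simp [block, ha'.2.1, ha'.2.2]))
  · have h1 : x ∈ oneLine j ↔ 0 < (pos j x).1 := by
      unfold oneLine
      rw [List.mem_map]
      constructor
      · rintro ⟨i, hi, rfl⟩
        rw [pos_apply]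
        exact mem_increasing.mp hi
      · intro hx
        exact ⟨pos j x, mem_increasing.mpr hx, apply_pos _ _⟩
    have h2 : 0 < (pos j x).1 ↔ pos j (-x) < pos j x := by
      rw [pos_neg, lt_iff_coe, coe_neg_pt]
      omega
    rw [h1, h2, hj, h.block_neg, List.mem_append, mem_increasing, mem_increasing, lt_iff_coe,
      coe_neg_pt]
    rcases α.block_cases x with ⟨h3, h4⟩ | ⟨h3, h4⟩ | ⟨h3, h5, h4⟩
    · rw [h4]
      simp [h3]
    · have h5 := h.neg_notMem_lastRun h3
      rw [neg_neg_pt] at h5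
      rw [h4]
      simp [midRun, h3, h5]
    · rw [h4]
      simp only [midRun, Set.mem_ofPred_eq, h3, h5]
      simp

/-- The upper endpoint is the last value before the last run: it is the largest of the middle run,
or, for a symmetric arc, the middle run is empty and it is the largest of the first run. -/
theorem pos_le_pos_upper (h : α.Admissible) {j : SignedPerm n}
    (hj : ∀ x y, pos j x < pos j y ↔ α.block x < α.block y ∨ (α.block x = α.block y ∧ x < y))
    {x : Pt n} (hx : α.block x ≠ 1) : pos j x ≤ pos j α.upper := by
  have hq := h.upper_pos
  have hsymm : -α.upper ∈ α.lastRun → -α = α := by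
    intro h1
    rcases h.neg_upper_notMem_low with h2 | h2
    · exact h2
    · rcases h1 with h1 | h1
      · exact absurd h1 h2
      · have := lt_iff_coe.mp h1.1
        rw [coe_neg_pt] at this
        omega
  rw [← not_lt, hj]
  have hP := α.upper_notMem_lastRun
  rcases α.block_cases x with ⟨-, h2⟩ | ⟨h1, h2⟩ | ⟨h1, h3, h2⟩
  · exact absurd h2 hx
  · rcases α.block_cases α.upper with ⟨g1, -⟩ | ⟨g1, g2⟩ | ⟨-, -, g2⟩
    · exact absurd g1 hP
    · have hle := lower_le_of_mem_lastRun h1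
      have hlow : α.lower = -α.upper := congrArg lower (hsymm g1).symm
      rw [hlow, le_iff_coe, coe_neg_pt, coe_neg_pt] at hle
      rw [h2, g2, lt_iff_coe]
      omega
    · rw [h2, g2]
      omega
  · have hle := le_upper_of_notMem h1 h3
    rcases α.block_cases α.upper with ⟨g1, -⟩ | ⟨g1, -⟩ | ⟨-, -, g2⟩
    · exact absurd g1 hP
    · exfalso
      have hs := hsymm g1
      have hlow : α.lower = -α.upper := congrArg lower hs.symm
      have h4 : α.lower < x := by
        refine lt_of_le_of_ne ?_ fun g => h1 (g ▸ α.lower_mem_lastRun)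
        have := le_upper_of_notMem h3 (by rwa [neg_neg_pt])
        rw [hlow, le_iff_coe, coe_neg_pt]
        rw [le_iff_coe, coe_neg_pt] at this
        omega
      have h5 : x < α.upper := lt_of_le_of_ne hle fun g => h3 (g ▸ g1)
      have h6 : x ∈ (-α).left := by
        rw [hs]
        exact mem_left.mpr ⟨h4, h5, fun g => h1 (Or.inl (Or.inr g))⟩
      exact h3 (Or.inl (Or.inr (mem_neg_left.mp h6)))
    · rw [h2, g2, lt_iff_coe]
      rw [le_iff_coe] at hle
      omega

theorem mem_delta (h : α.Admissible) {j : SignedPerm n}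
    (hj : ∀ x y, pos j x < pos j y ↔ α.block x < α.block y ∨ (α.block x = α.block y ∧ x < y)) :
    α ∈ delta j := by
  refine mem_delta_iff.mpr ⟨⟨pos_upper_lt hj, fun z h1 h2 => ?_⟩, ?_⟩
  · by_cases hz : α.block (j.1 z) = 1
    · have := pos_lower_le hj hz
      rw [pos_apply] at this
      exact this.not_gt h2
    · have := h.pos_le_pos_upper hj hz
      rw [pos_apply] at this
      exact this.not_gt h1
  · ext x
    constructor
    · intro hx
      have h1 := α.right_subset hx
      refine ⟨h1.1, h1.2, (hj _ _).mpr (Or.inr ⟨?_, h1.1⟩)⟩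
      rw [block_lower, block_eq_one_iff.mpr ((mem_right_iff_of_lt h1.1 h1.2).mp hx)]
    · rintro ⟨h1, h2, h3⟩
      rw [mem_right_iff_of_lt h1 h2, ← block_eq_one_iff]
      have := α.block_le_one x
      rw [hj, block_lower] at h3
      omega

theorem eq_of_mem_delta (h : α.Admissible) {j : SignedPerm n}
    (hj : ∀ x y, pos j x < pos j y ↔ α.block x < α.block y ∨ (α.block x = α.block y ∧ x < y))
    {β : Arc n} (hβ : β ∈ delta j) (h1 : α.block β.lower = 1) : β = α := by
  have hc := (mem_delta_iff.mp hβ).1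
  have h2 : α.block β.upper ≠ 1 := by
    intro h2
    have := (hj _ _).mp hc.lt
    rw [h1, h2] at this
    rcases this with g | g
    · exact lt_irrefl _ g
    · exact β.lower_lt_upper.asymm g.2
  refine eq_of_upper_eq hβ (h.mem_delta hj) ((pos_inj (π := j)).mp ?_)
  refine (h.pos_le_pos_upper hj h2).eq_of_not_lt fun g => ?_
  exact hc.2 g ((pos_upper_lt hj).trans_le (pos_lower_le hj h1))

theorem delta_eq (h : α.Admissible) {j : SignedPerm n}
    (hj : ∀ x y, pos j x < pos j y ↔ α.block x < α.block y ∨ (α.block x = α.block y ∧ x < y)) :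
    delta j = {α, -α} := by
  ext β
  constructor
  · intro hβ
    by_cases h1 : α.block β.lower = 1
    · exact Or.inl (h.eq_of_mem_delta hj hβ h1)
    · refine Or.inr ?_
      -- A descent must change runs; if it does not enter the last run, it leaves the first one, so
      -- its mirror image enters the last.
      have h2 : α.block (-β).lower = 1 := by
        rw [Arc.neg_lower, h.block_neg]
        have h3 := (hj _ _).mp (mem_delta_iff.mp hβ).1.lt
        have h4 := lt_iff_coe.mp β.lower_lt_upper
        rw [lt_iff_coe] at h3
        rcases α.block_cases β.lower with ⟨-, g⟩ | ⟨-, g⟩ | ⟨-, -, g⟩ <;>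
        rcases α.block_cases β.upper with ⟨-, g'⟩ | ⟨-, g'⟩ | ⟨-, -, g'⟩ <;> omega
      rw [Set.mem_singleton_iff, ← h.eq_of_mem_delta hj (neg_mem_delta hβ) h2, Arc.neg_neg]
  · rintro (rfl | rfl)
    · exact h.mem_delta hj
    · exact neg_mem_delta (h.mem_delta hj)

end Admissible

end Arc

/-! ### The word of a preferred arc -/

theorem Arc.mem_left_iff {α : Arc n} {x : Pt n} :
    x ∈ α.left ↔ α.lower < x ∧ x < α.upper ∧ x ∉ α.low := by
  rw [Arc.mem_left]
  refine and_congr_right fun h1 => and_congr_right fun _ => not_congr ?_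
  exact ⟨Or.inr, fun h => h.resolve_left h1.ne'⟩

theorem Arc.lower_eq_neg_upper {α : Arc n} (h : -α = α) : α.lower = -α.upper :=
  congrArg Arc.lower h.symm

/-- A value in `low` whose negative is also in `low` would put `-α` to the right of `α` there,
against the choice of `α` in an overlapping pair. The other two cases follow from symmetry and from
positivity. -/
theorem IsPreferred.admissible {α : Arc n} (hp : IsPreferred α)
    (hα : -α = α ∨ α.Compatible (-α)) : α.Admissible := by
  have hpq := lt_iff_coe.mp α.lower_lt_upper
  by_cases hs : -α = α
  · have hlow := eq_iff_coe.mp (Arc.lower_eq_neg_upper hs)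
    rw [coe_neg_pt] at hlow
    refine ⟨by omega, ?_, Or.inl hs⟩
    rintro x (rfl | hx) hx'
    · have := lt_iff_coe.mp (Arc.lt_upper_of_mem_low hx')
      rw [coe_neg_pt] at this
      omega
    · have h1 : -x ∈ α.left := by rwa [← hs, Arc.mem_neg_left, neg_neg_pt]
      exact (Arc.mem_left_iff.mp h1).2.2 hx'
  · have hc := hα.resolve_left hs
    rcases hp.resolve_left hs with hp | ⟨-, hp, hq, hr⟩
    · refine ⟨by omega, fun x hx hx' => ?_, Or.inr fun hx' => ?_⟩
      · have h1 := le_iff_coe.mp (Arc.lower_le_of_mem_low hx)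
        have h2 := le_iff_coe.mp (Arc.lower_le_of_mem_low hx')
        rw [coe_neg_pt] at h2
        omega
      · have h2 := le_iff_coe.mp (Arc.lower_le_of_mem_low hx')
        rw [coe_neg_pt] at h2
        omega
    · have key : ∀ x, (-x ∈ α.right ∨ (-α).IsEndpoint x) → (x ∈ α.right ∨ α.IsEndpoint x) →
          (-α).IsEndpoint x ∧ α.IsEndpoint x := by
        intro x h1 h2
        by_contra h3
        refine hc.2.2 ⟨hr, x, ?_, h2, h3⟩
        rwa [Arc.mem_neg_left]
      have hend : ∀ {x}, (-α).IsEndpoint x ↔ x = -α.upper ∨ x = -α.lower := Iff.rfl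
      have hne : α.upper ≠ -α.lower := hc.1
      refine ⟨hq, fun x hx hx' => ?_, Or.inr fun hx => ?_⟩
      · have h1 : -x ∈ α.right ∨ (-α).IsEndpoint x := by
          refine hx'.symm.imp id fun g => hend.mpr (Or.inr ?_)
          rw [← g, neg_neg_pt]
        have h2 := key x h1 (hx.symm.imp id Or.inl)
        have h3 := lt_iff_coe.mp (Arc.lt_upper_of_mem_low hx)
        have h4 := lt_iff_coe.mp (Arc.lt_upper_of_mem_low hx')
        have hx0 := x.2.1
        have h5 := hend.mp h2.1
        have h6 : x = α.lower ∨ x = α.upper := h2.2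
        simp only [ne_eq, eq_iff_coe, coe_neg_pt] at *
        omega
      · rcases hx with hx | hx
        · exact hne (by rw [← hx, neg_neg_pt])
        · have h2 := key α.upper (Or.inl hx) (Or.inr (Or.inr rfl))
          have h5 := hend.mp h2.1
          simp only [ne_eq, eq_iff_coe, coe_neg_pt] at *
          omega

/-- Reduces the comparison of words for a pair of arcs to two set identities, one for each run; the
only descent allowed is from `q` to `p`. -/
theorem increasing_append_pair {p q : Pt n} {A A' B B' M P : Set (Pt n)}
    (hA : ∀ a ∈ A, ∀ b ∈ A', a < b) (hA' : ∀ a ∈ A ∪ A', a < q)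
    (hB : ∀ a ∈ B, ∀ b ∈ B', a < b) (hB' : ∀ b ∈ B ∪ B', p < b)
    (hM : A ∪ A' ∪ {q} = M) (hP : {p} ∪ (B ∪ B') = P) :
    increasing A ++ increasing A' ++ [q, p] ++ increasing B ++ increasing B' =
      increasing M ++ increasing P := by
  rw [← hM, ← hP, ← increasing_append (A := A ∪ A'), ← increasing_append (B := B ∪ B'),
    increasing_singleton, increasing_singleton, increasing_append hA, ← increasing_append hB]
  · simp
  · rintro a rfl b hb
    exact hB' b hb
  · rintro a ha b rfl
    exact hA' a ha

theorem Arc.Admissible.jiWord_eq {α : Arc n} (h : α.Admissible)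
    (hs : α.lower = -α.upper → -α = α) :
    jiWord α = increasing α.midRun ++ increasing α.lastRun := by
  have hq := h.upper_pos
  have hpq := lt_iff_coe.mp α.lower_lt_upper
  have hR : ∀ x ∈ α.right, α.lower.1 < x.1 ∧ x.1 < α.upper.1 := fun x hx => α.right_subset hx
  have hlast : ∀ x, x ∈ α.lastRun ↔ x ∈ α.low ∨ (α.upper.1 < x.1 ∧ -x ∉ α.low) := fun _ => Iff.rfl
  have hlow : ∀ x, x ∈ α.low ↔ x.1 = α.lower.1 ∨ x ∈ α.right := fun x => by
    rw [← eq_iff_coe]; rfl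
  have hleft : ∀ x, x ∈ α.left ↔ α.lower.1 < x.1 ∧ x.1 < α.upper.1 ∧ x ∉ α.low := fun x =>
    Arc.mem_left_iff
  have hmid : ∀ x, x ∈ α.midRun ↔ 0 < x.1 ∧ x ∉ α.lastRun ∧ -x ∉ α.lastRun := fun _ => Iff.rfl
  have hSS : ∀ x, x ∈ α.low → -x ∉ α.low := h.neg_notMem_low
  unfold jiWord
  simp only []
  split_ifs with c1 c2 c3
  · have hsym : ∀ x, x ∈ α.right ↔ -x ∈ α.left := fun x => by
      conv_lhs => rw [← hs c1, Arc.mem_neg_right]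
    have c1' : α.lower.1 = -α.upper.1 := congrArg Subtype.val c1
    -- For a symmetric arc, negation exchanges left and right, so each point between the endpoints
    -- or its negative is in the last run.
    have hm : α.midRun = ∅ := by
      ext x
      have g1 := hsym x
      have g2 := hsym (-x)
      have g3 := hR x
      have g4 := hR (-x)
      rw [Set.mem_empty_iff_false]
      simp only [hmid, hlast, hlow, hleft, neg_neg_pt, coe_neg_pt] at g1 g2 g3 g4 ⊢
      clear hsym hlast hlow hleft hmid hSS hR
      grind
    rw [hm, increasing_empty, List.nil_append, ← increasing_singleton, increasing_append,
      increasing_append]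
    · congr 1
      ext x
      have g1 := hR x
      have g2 := hR (-x)
      have g3 := hSS x
      simp only [Set.mem_union, Set.mem_singleton_iff, Set.mem_ofPred_eq, hlast, hlow, coe_neg_pt,
        lt_iff_coe, eq_iff_coe] at g1 g2 g3 ⊢
      clear hlast hlow hleft hmid hSS hR hm
      grind
    · rintro a (rfl | ha) b hb
      · exact α.lower_lt_upper.trans hb
      · exact (α.right_subset ha).2.trans hb
    · rintro a rfl b hb
      exact (α.right_subset hb).1
  · have hm : ∀ x : Pt n, x.1 = α.upper.1 → -x ∉ α.low := fun x hx => by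
      rw [Subtype.ext hx]
      exact h.neg_upper_notMem_low.resolve_left fun g => c1 (Arc.lower_eq_neg_upper g)
    apply increasing_append_pair
    · exact fun a ha b hb => ha.2.trans (Arc.mem_left.mp hb).1
    · rintro a (ha | ha)
      · exact ha.2.trans α.lower_lt_upper
      · exact (Arc.mem_left.mp ha).2.1
    · exact fun a ha b hb => (α.right_subset ha).2.trans hb
    · rintro b (hb | hb)
      · exact (α.right_subset hb).1
      · exact α.lower_lt_upper.trans hb
    · ext x
      have g1 := hR x
      have g2 := hR (-x)
      have g3 := hSS x
      have g4 := hm x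
      simp only [Set.mem_union, Set.mem_singleton_iff, Set.mem_ofPred_eq, hmid, hlast, hlow, hleft,
        neg_neg_pt, coe_neg_pt, lt_iff_coe, eq_iff_coe] at g1 g2 g3 g4 c1 c2 ⊢
      clear hlast hlow hleft hmid hSS hR hm
      grind
    · ext x
      have g1 := hR x
      have g2 := hR (-x)
      have g3 := hSS x
      have g4 := hm x
      simp only [Set.mem_union, Set.mem_singleton_iff, Set.mem_ofPred_eq, hlast, hlow,
        coe_neg_pt, lt_iff_coe, eq_iff_coe] at g1 g2 g3 g4 c1 c2 ⊢
      clear hlast hlow hleft hmid hSS hR hm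
      grind
  · have hm : ∀ x : Pt n, x.1 = α.upper.1 → -x ∉ α.low := fun x hx => by
      rw [Subtype.ext hx]
      exact h.neg_upper_notMem_low.resolve_left fun g => c1 (Arc.lower_eq_neg_upper g)
    apply increasing_append_pair
    · exact fun a ha b hb => ha.2.1.trans hb.1
    · rintro a (ha | ha)
      · exact ha.2.1.trans c3
      · exact ha.2.1
    · exact fun a ha b hb => (α.right_subset ha).2.trans hb
    · rintro b (hb | hb)
      · exact (α.right_subset hb).1
      · exact α.lower_lt_upper.trans hb
    · ext x
      have g1 := hR x
      have g2 := hR (-x)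
      have g3 := hSS x
      have g4 := hm x
      simp only [Set.mem_union, Set.mem_singleton_iff, Set.mem_ofPred_eq, hmid, hlast, hlow, hleft,
        neg_neg_pt, coe_neg_pt, lt_iff_coe, eq_iff_coe] at g1 g2 g3 g4 c1 c2 c3 ⊢
      clear hlast hlow hleft hmid hSS hR hm
      grind
    · ext x
      have g1 := hR x
      have g2 := hR (-x)
      have g3 := hSS x
      have g4 := hm x
      simp only [Set.mem_union, Set.mem_singleton_iff, Set.mem_ofPred_eq, hlast, hlow,
        coe_neg_pt, lt_iff_coe, eq_iff_coe] at g1 g2 g3 g4 c1 c2 c3 ⊢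
      clear hlast hlow hleft hmid hSS hR hm
      grind
  · have hm : ∀ x : Pt n, x.1 = α.upper.1 → -x ∉ α.low := fun x hx => by
      rw [Subtype.ext hx]
      exact h.neg_upper_notMem_low.resolve_left fun g => c1 (Arc.lower_eq_neg_upper g)
    have hqp : α.upper ≤ -α.lower := not_lt.mp c3
    -- Here three sets follow `p` and only one precedes `q`, so the first two after `p` are merged
    -- and `A'` is empty.
    have key := increasing_append_pair (p := α.lower) (q := α.upper)
      (A := {x | 0 < x.1 ∧ x < α.upper ∧ x ∈ α.left ∧ -x ∈ α.left}) (A' := ∅)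
      (B := α.right ∪ {x | α.upper < x ∧ x < -α.lower ∧ -x ∈ α.left}) (B' := {x | -α.lower < x})
      (M := α.midRun) (P := α.lastRun) ?_ ?_ ?_ ?_ ?_ ?_
    · rw [← key, ← increasing_append (A := α.right), increasing_empty]
      · simp only [List.append_nil, List.append_assoc]
      · exact fun a ha b hb => (α.right_subset ha).2.trans hb.1
    · exact fun _ _ _ hb => hb.elim
    · rintro a (ha | ha)
      · exact ha.2.1
      · exact ha.elim
    · rintro a (ha | ha) b hb
      · exact ((α.right_subset ha).2.trans_le hqp).trans hb
      · exact ha.2.1.trans hb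
    · rintro b ((hb | hb) | hb)
      · exact (α.right_subset hb).1
      · exact α.lower_lt_upper.trans hb.1
      · exact (α.lower_lt_upper.trans_le hqp).trans hb
    · ext x
      have g1 := hR x
      have g2 := hR (-x)
      have g3 := hSS x
      have g4 := hm x
      simp only [Set.mem_union, Set.mem_singleton_iff, Set.mem_ofPred_eq, hmid, hlast, hlow, hleft,
        neg_neg_pt, coe_neg_pt, lt_iff_coe, eq_iff_coe] at g1 g2 g3 g4 c1 c2 c3 ⊢
      clear hlast hlow hleft hmid hSS hR hm
      grind
    · ext x
      have g1 := hR x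
      have g2 := hR (-x)
      have g3 := hSS x
      have g4 := hm x
      simp only [Set.mem_union, Set.mem_singleton_iff, Set.mem_ofPred_eq, hlast, hlow, hleft,
        coe_neg_pt, lt_iff_coe, eq_iff_coe] at g1 g2 g3 g4 c1 c2 c3 ⊢
      clear hlast hlow hleft hmid hSS hR hm
      grind

theorem delta_and_oneLine {α : Arc n} (hp : IsPreferred α)
    (hα : -α = α ∨ α.Compatible (-α)) :
    ∃ j : SignedPerm n, oneLine j = jiWord α ∧ delta j = {α, -α} := by
  have h := hp.admissible hα
  obtain ⟨j, hj⟩ := h.exists_signedPerm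
  refine ⟨j, ?_, h.delta_eq hj⟩
  rw [h.oneLine_eq hj, h.jiWord_eq fun g => ?_]
  exact hα.resolve_right fun hc => hc.2.1 g

/-! ### Choice of the preferred arc, and the correspondence -/

theorem Arc.rightAt_or_rightAt {α β : Arc n} {x : Pt n} (hx : α.IsEndpoint x)
    (h1 : β.lower < x) (h2 : x < β.upper) : α.RightAt β x ∨ β.RightAt α x := by
  have hβ : ¬ β.IsEndpoint x := by
    rintro (rfl | rfl)
    · exact lt_irrefl _ h1
    · exact lt_irrefl _ h2
  by_cases h : x ∈ β.right
  · exact Or.inl ⟨Or.inr hx, Or.inl h, fun g => hβ g.2⟩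
  · exact Or.inr ⟨Or.inl (Arc.mem_left.mpr ⟨h1, h2, h⟩), Or.inr hx, fun g => hβ g.1⟩

theorem Arc.Compatible.symm {α β : Arc n} (h : α.Compatible β) : β.Compatible α :=
  ⟨h.1.symm, h.2.1.symm, fun g => h.2.2 ⟨g.2, g.1⟩⟩

theorem exists_isPreferred {α : Arc n} (hα : -α = α ∨ α.Compatible (-α)) :
    IsPreferred α ∨ IsPreferred (-α) := by
  by_cases hs : -α = α
  · exact Or.inl (Or.inl hs)
  have hc := hα.resolve_left hs
  have hs' : - -α ≠ -α := by rw [Arc.neg_neg]; exact fun g => hs g.symm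
  have hp0 := α.lower.2.1
  have hq0 := α.upper.2.1
  by_cases h1 : 0 < α.lower.1
  · exact Or.inl (Or.inr (Or.inl h1))
  by_cases h2 : 0 < α.upper.1
  · have hr : α.RightOf (-α) ∨ (-α).RightOf α := by
      -- The lower of the two upper endpoints lies strictly between the endpoints of the other arc
      -- and decides which arc is on the right.
      have h3 : α.upper.1 ≠ -α.lower.1 := fun g => hc.1 (Subtype.ext g)
      rcases lt_or_gt_of_ne h3 with h4 | h4
      · rcases Arc.rightAt_or_rightAt (α := α) (β := -α) (x := α.upper) (Or.inr rfl)
          (by rw [Arc.neg_lower, lt_iff_coe, coe_neg_pt]; omega)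
          (by rw [Arc.neg_upper, lt_iff_coe, coe_neg_pt]; omega) with g | g
        · exact Or.inl ⟨_, g⟩
        · exact Or.inr ⟨_, g⟩
      · rcases Arc.rightAt_or_rightAt (α := -α) (β := α) (x := -α.lower) (Or.inr rfl)
          (by rw [lt_iff_coe, coe_neg_pt]; omega)
          (by rw [lt_iff_coe, coe_neg_pt]; omega) with g | g
        · exact Or.inr ⟨_, g⟩
        · exact Or.inl ⟨_, g⟩
    rcases hr with hr | hr
    · exact Or.inl (Or.inr (Or.inr ⟨hs, by omega, h2, hr⟩))
    · refine Or.inr (Or.inr (Or.inr ⟨hs', ?_, ?_, by rwa [Arc.neg_neg]⟩))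
      · rw [Arc.neg_lower, coe_neg_pt]; omega
      · rw [Arc.neg_upper, coe_neg_pt]; omega
  · refine Or.inr (Or.inr (Or.inl ?_))
    rw [Arc.neg_lower, coe_neg_pt]
    omega

theorem eq_pair_and_compatible {A : Set (Arc n)} (hA : IsSymmetricArc A ∨ IsSymmetricPair A)
    {α : Arc n} (hα : α ∈ A) : A = {α, -α} ∧ (-α = α ∨ α.Compatible (-α)) := by
  rcases hA with ⟨β, h, rfl⟩ | ⟨β, -, h, rfl⟩
  · obtain rfl : α = β := hα
    exact ⟨by rw [h, Set.pair_eq_singleton], Or.inl h⟩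
  · refine ⟨(pair_eq_of_mem hα).symm, Or.inr ?_⟩
    rcases hα with rfl | rfl
    · exact h
    · rw [Arc.neg_neg]
      exact h.symm

theorem exists_mem_isPreferred {A : Set (Arc n)} (hA : IsSymmetricArc A ∨ IsSymmetricPair A) :
    ∃ α ∈ A, IsPreferred α := by
  obtain ⟨α, rfl⟩ := exists_eq_pair hA
  rcases exists_isPreferred (eq_pair_and_compatible hA (α := α) (by simp)).2 with hp | hp
  · exact ⟨α, by simp, hp⟩
  · exact ⟨-α, by simp, hp⟩

/-- For any preferred arc of `A` there is a `k` with both the required word and the diagram `A`. As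
`oneLine` and `delta` are injective, both conditions say `j = k`, so uniqueness of the preferred arc
is not needed. -/
theorem corresponds_iff {A : Set (Arc n)} (hA : IsSymmetricArc A ∨ IsSymmetricPair A)
    (j : SignedPerm n) : Corresponds j A ↔ delta j = A := by
  have key' : ∀ α ∈ A, IsPreferred α → (oneLine j = jiWord α ↔ delta j = A) := by
    intro α hα hp
    obtain ⟨h1, h2⟩ := eq_pair_and_compatible hA hα
    obtain ⟨k, h3, h4⟩ := delta_and_oneLine hp h2
    rw [← h3, h1, ← h4, oneLine_injective.eq_iff, delta_injective.eq_iff]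
  constructor
  · rintro ⟨α, hα, hp, hj⟩
    exact (key' α hα hp).mp hj
  · intro hj
    obtain ⟨α, hα, hp⟩ := exists_mem_isPreferred hA
    exact ⟨α, hα, hp, (key' α hα hp).mpr hj⟩

theorem exists_delta_eq {A : Set (Arc n)} (hA : IsSymmetricArc A ∨ IsSymmetricPair A) :
    ∃ j : SignedPerm n, delta j = A := by
  obtain ⟨α, hα, hp⟩ := exists_mem_isPreferred hA
  obtain ⟨h1, h2⟩ := eq_pair_and_compatible hA hα
  obtain ⟨j, -, hj⟩ := delta_and_oneLine hp h2
  exact ⟨j, hj.trans h1.symm⟩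

end TypeB

/-- The first part says that each symmetric arc or pair `A` of `δ(π)` has exactly one
corresponding signed permutation, and that this is the join-irreducible element `j` with
`δ(j) = A`; the second part describes the canonical join representation of `π`. -/
theorem theoremB (n : ℕ) (π : SignedPerm n) :
    (∀ A ∈ symmetricParts (delta π),
      (∃! j : SignedPerm n, Corresponds j A) ∧
      ∀ j : SignedPerm n, Corresponds j A ↔ IsJoinIrreducible j ∧ delta j = A) ∧
    IsCanonicalJoinRep π {j | ∃ A ∈ symmetricParts (delta π), Corresponds j A} := by
  refine ⟨fun A hA => ?_, ?_⟩
  · obtain ⟨j, hj⟩ := exists_delta_eq hA.1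
    refine ⟨⟨j, (corresponds_iff hA.1 j).mpr hj, fun k hk => ?_⟩, fun k => ?_⟩
    · exact delta_injective (((corresponds_iff hA.1 k).mp hk).trans hj.symm)
    · rw [corresponds_iff hA.1]
      obtain ⟨α, rfl⟩ := exists_eq_pair hA.1
      exact ⟨fun h => ⟨isJoinIrreducible_of_delta_eq h, h⟩, fun h => h.2⟩
  · refine isCanonicalJoinRep_of_delta ?_ fun α hα => ?_
    · rintro j ⟨A, hA, hj⟩
      obtain ⟨α, rfl⟩ := exists_eq_pair hA.1
      exact ⟨α, hA.2 (by simp), (corresponds_iff hA.1 j).mp hj⟩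
    · have hA := mem_symmetricParts hα
      obtain ⟨j, hj⟩ := exists_delta_eq hA.1
      exact ⟨j, ⟨_, hA, (corresponds_iff hA.1 j).mpr hj⟩, hj⟩
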